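/- Let $(X,d)$ be a nonempty complete separable Busemann space, that is, a geodesic metric space in which $t\mapsto d(\gamma(t),\gamma'(t))$ is convex on $[0,1]$ for any two geodesics $\gamma,\gamma'$ parametrized on $[0,1]$ proportionally to arc length. Let $P^1(X)$ be the set of Borel probability measures $\mu$ on $X$ with $\int_X d(x,y)\,d\mu(y)<\infty$ for all $x \in X$, let $$W_1(\mu_1,\mu_2)=\inf_{\nu}\int_{X\times X}d(x,y)\,d\nu(x,y),$$ where $\nu$ ranges over all probability measures on $X\times X$ with marginals $\mu_1$ and $\mu_2$, and let $P_{\mathbb Q}(X)\subset P^1(X)$ be the set of measures carried by finitely many atoms, all of rational mass. Then the following hold. 1. Any two points $x,y \in X$ have exactly one midpoint, i.e. exactly one point $m$ with $d(x,m)=d(m,y)=\frac12 d(x,y)$. 2. Let $bar_1(x)=x$, let $bar_2(x,y)$ be the midpoint of $x$ and $y$, and for $n\ge 3$ define $bar_n(x_1,\dots,x_n)$ as the common limit, as $k\to\infty$, of the sequences $(x_i^{(k)})_k$, $1\le i\le n$, given by $x_i^{(0)}=x_i$ and $x_i^{(k+1)}=bar_{n-1}(x_1^{(k)},\dots,x_{i-1}^{(k)},x_{i+1}^{(k)},\dots,x_n^{(k)})$.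 These limits exist and do not depend on $i$, so that $bar_n$ is well defined for all $n\ge 1$. 3. The set $P_{\mathbb Q}(X)$ consists exactly of the measures $\frac1n(\delta_{x_1}+\dots+\delta_{x_n})$ with $n\ge 1$ and $x_1,\dots,x_n\in X$ not necessarily distinct, and it is $W_1$-dense in $P^1(X)$. 4. There is a map $bar^\star:P^1(X)\to X$ such that: * for every $n\ge1$ and every family $Q=(x_1,\dots,x_n)$ of points of $X$, if $Q^k$ denotes the concatenation of $k$ copies of $Q$, then $bar_{nk}(Q^k)\to bar^\star\big(\frac1n(\delta_{x_1}+\dots+\delta_{x_n})\big)$ as $k\to\infty$ (in particular the limit exists and depends only on the measure); * $d\big(bar^\star(\mu_1),bar^\star(\mu_2)\big)\le W_1(\mu_1,\mu_2)$ for all $\mu_1,\mu_2\in P^1(X)$; * $bar^\star$ is the only $W_1$-continuous map $P^1(X)\to X$ that extends its restriction to $P_{\mathbb Q}(X)$; * $bar^\star(f_*\mu)=f(bar^\star(\mu))$ for every surjective isometry $f:X\to X$ and every $\mu\in P^1(X)$. Moreover, let $E$ be a separable real Banach space, with $d(x,y)=\|x-y\|$. Then the identity of $E$ is Bochner integrable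 with respect to every $\mu\in P^1(E)$, and with $bar_2(x,y)=\frac{x+y}2$ in the construction of part 2, the common limits defining $bar_n$, $n\ge3$, exist, and the map $bar^\star(\mu)=\int_E x\,d\mu(x)$ has the four properties listed in part 4. -/

import Mathlib

open MeasureTheory Filter Topology Set
open scoped ENNReal

noncomputable section

/-! ### Busemann spaces -/

section Busemann

variable {X : Type*} [MetricSpace X]

/-- `γ`, restricted to `[0,1]`, is a geodesic from `x` to `y`, parametrized proportionally to
arc length. -/
def IsGeodesicFromTo (γ : ℝ → X) (x y : X) : Prop :=
  γ 0 = x ∧ γ 1 = y ∧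
    ∀ s ∈ Icc (0 : ℝ) 1, ∀ t ∈ Icc (0 : ℝ) 1, dist (γ s) (γ t) = |s - t| * dist x y

variable (X) in
/-- Nonpositive curvature in the sense of Busemann: `X` is geodesic and the distance function
along any two geodesics is convex. -/
structure IsBusemannSpace : Prop where
  exists_geodesic : ∀ x y : X, ∃ γ : ℝ → X, IsGeodesicFromTo γ x y
  convex_dist : ∀ (γ γ' : ℝ → X) (x y x' y' : X),
    IsGeodesicFromTo γ x y → IsGeodesicFromTo γ' x' y' →
      ConvexOn ℝ (Icc (0 : ℝ) 1) (fun t => dist (γ t) (γ' t))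

/-- `m` is a midpoint of `x` and `y` for the metric. -/
def IsMetricMidpoint (x y m : X) : Prop :=
  dist x m = dist x y / 2 ∧ dist m y = dist x y / 2

/-- The metric midpoint of `x` and `y` (meaningful where it exists and is unique). -/
def metricMidpoint (x y : X) : X :=
  @Classical.epsilon X ⟨x⟩ (IsMetricMidpoint x y)

end Busemann

/-! ### Iterated barycenters of finite families -/

section IterBar

variable {X : Type*}

/-- Given a barycenter `f` for families of `n` points, replace each entry of a family of `n + 1`
points by the `f`-barycenter of the other `n` points. -/
def replaceStep {n : ℕ} (f : (Fin n → X) → X) (x : Fin (n + 1) → X) : Fin (n + 1) → X :=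
  fun i => f (fun j => x (i.succAbove j))

/-- The iterated barycenter `bar_n (x_1, …, x_n)`, built from a midpoint map `mid`:
`bar_1 (x) = x`, `bar_2 (x, y) = mid x y`, and for `n ≥ 3` the point `bar_n (x)` is the limit of
the entries of the families obtained by iterating `replaceStep bar_{n-1}`. (The value for the
empty family is arbitrary.) -/
def iterBar [TopologicalSpace X] [Nonempty X] (mid : X → X → X) :
    (n : ℕ) → (Fin n → X) → X
  | 0, _ => Classical.arbitrary X
  | 1, x => x 0
  | 2, x => mid (x 0) (x 1)
  | n + 3, x => limUnder atTop (fun k : ℕ => ((replaceStep (iterBar mid (n + 2)))^[k] x) 0)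

end IterBar

/-! ### Probability measures with finite first moment and the 1-Wasserstein metric -/

section Wasserstein

/-- `P¹(X)`: probability measures on `X` with finite first moment. -/
def P1 (X : Type*) [MetricSpace X] [MeasurableSpace X] : Type _ :=
  {μ : Measure X // IsProbabilityMeasure μ ∧ ∀ x : X, ∫⁻ y, edist x y ∂μ < ∞}

variable {X : Type*} [MetricSpace X] [MeasurableSpace X]

/-- The 1-Wasserstein distance: infimum of the transport cost over all couplings. -/
def W1 (μ ν : P1 X) : ℝ≥0∞ :=
  ⨅ (π : Measure (X × X)) (_ : π.map Prod.fst = μ.1 ∧ π.map Prod.snd = ν.1),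
    ∫⁻ p, edist p.1 p.2 ∂π

/-- `P_ℚ(X)`: measures carried by finitely many atoms, all of rational mass. -/
def IsRationalAtomic (μ : P1 X) : Prop :=
  (∃ s : Finset X, μ.1 (↑s)ᶜ = 0) ∧ ∀ x : X, ∃ q : ℚ, μ.1.real {x} = (q : ℝ)

variable [BorelSpace X]

/-- The measure `(1/n) (δ_{x_1} + ⋯ + δ_{x_n})`, `n ≥ 1`. -/
def P1.uniform {n : ℕ} (hn : 0 < n) (x : Fin n → X) : P1 X :=
  ⟨(n : ℝ≥0∞)⁻¹ • ∑ i, Measure.dirac (x i), by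
    have h0 : (n : ℝ≥0∞) ≠ 0 := by exact_mod_cast hn.ne'
    refine ⟨⟨?_⟩, fun z => ?_⟩
    · simp [ENNReal.inv_mul_cancel h0 (ENNReal.natCast_ne_top n)]
    · rw [lintegral_smul_measure, lintegral_finsetSum_measure]
      refine ENNReal.mul_lt_top (by simp [hn]) (ENNReal.sum_lt_top.2 fun i _ => ?_)
      rw [lintegral_dirac]
      exact edist_lt_top _ _⟩

/-- The action of isometries of `X` on `P¹(X)` by push-forward. -/
def P1.map (f : X ≃ᵢ X) (μ : P1 X) : P1 X :=
  ⟨μ.1.map f, by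
    have := μ.2.1
    refine ⟨Measure.isProbabilityMeasure_map f.continuous.measurable.aemeasurable, fun z => ?_⟩
    have h := lintegral_map_equiv (μ := μ.1) (fun y => edist z y) f.toHomeomorph.toMeasurableEquiv
    have e : (⇑f.toHomeomorph.toMeasurableEquiv : X → X) = f := rfl
    rw [e] at h
    rw [h]
    have h2 := μ.2.2 (f.symm z)
    refine lt_of_eq_of_lt (lintegral_congr fun y => ?_) h2
    rw [← f.edist_eq (f.symm z) y, f.apply_symm_apply]⟩

/-- `b : P¹(X) → X` is continuous for the 1-Wasserstein metric. -/
def W1Continuous (b : P1 X → X) : Prop :=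
  ∀ μ : P1 X, ∀ ε : ℝ≥0∞, 0 < ε → ∃ δ : ℝ≥0∞, 0 < δ ∧
    ∀ ν : P1 X, W1 ν μ < δ → edist (b ν) (b μ) < ε

/-- `b` is the canonical barycenter map `bar⋆` built from the midpoint map `mid`, with its
properties. -/
structure IsBarStar [Nonempty X] (mid : X → X → X) (b : P1 X → X) : Prop where
  /-- The iterated barycenters of finite families are well defined: in the procedure defining
  `bar_n`, `n ≥ 3`, all `n` sequences converge to the point `bar_n (x)`. -/
  iterBar_tendsto : ∀ (n : ℕ) (x : Fin (n + 3) → X) (i : Fin (n + 3)),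
    Tendsto (fun k : ℕ => ((replaceStep (iterBar mid (n + 2)))^[k] x) i) atTop
      (𝓝 (iterBar mid (n + 3) x))
  /-- For `Q = (x_1, …, x_n)`, the value of `b` at `(1/n) (δ_{x_1} + ⋯ + δ_{x_n})` is the limit
  of `bar_{nk} (Q^k)`. -/
  uniform : ∀ (n : ℕ) (hn : 0 < n) (Q : Fin n → X),
    Tendsto (fun k : ℕ => iterBar mid (k * n) (Fin.repeat k Q)) atTop (𝓝 (b (P1.uniform hn Q)))
  /-- `b` is 1-Lipschitz for the 1-Wasserstein metric. -/
  contract : ∀ μ ν : P1 X, edist (b μ) (b ν) ≤ W1 μ ν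
  /-- `b` is the only continuous extension of its restriction to `P_ℚ(X)`. -/
  extension_unique : ∀ b' : P1 X → X, W1Continuous b' →
    (∀ μ : P1 X, IsRationalAtomic μ → b' μ = b μ) → b' = b
  /-- `b` is equivariant under isometries. -/
  equivariant : ∀ (f : X ≃ᵢ X) (μ : P1 X), b (P1.map f μ) = f (b μ)

end Wasserstein

end

/-! ### Midpoints in Busemann spaces -/

section BusemannMidpoint

variable {X : Type*} [MetricSpace X]

/-! Convexity along geodesics makes the midpoint map contract average distance. This passes up the
induction: if `bar_n` is idempotent, symmetric and 1-Lipschitz for the average distance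
(`SymmetricMean`), then one step of the procedure on `n + 1` points divides mutual distances by `n`,
so the entries converge geometrically to a common point, and the limit inherits the three
properties.

For `bar⋆`, let `V_N(z)` (`meanDist`) be the expected distance from `z` to `bar_N` of `N`
independent points of law `μ`. Since `bar_{N+1}` is unchanged when each entry is replaced by the
`bar_N` of the others, `V_N(z)` decreases in `N` (`meanDist_succ_le`). For finitely supported `μ`,
`bar_N` depends only on the counts of each atom, which fluctuate by `√N`, so `V_N(z)` is `O(1/√N)`
for a suitable `z`. A coupling changes `V_N` by at most its cost, so `V_N(z)` can be made
arbitrarily small for every `μ` in `P¹`. As `d(z, w) ≤ V_N(z) + V_N(w)`, near-minimizers are Cauchy;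
`bar⋆(μ)` is their limit, the only point where `V_N → 0`.

The contraction property, the limit along `Q^k` and equivariance all follow from this
characterization. Uniqueness of the extension is density of `P_ℚ`, obtained by quantizing and
rounding masses. In a Banach space `bar_n` is the arithmetic mean, and that same uniqueness
identifies `bar⋆` with the integral. -/

theorem IsGeodesicFromTo.isMetricMidpoint {γ : ℝ → X} {x y : X} (h : IsGeodesicFromTo γ x y) :
    IsMetricMidpoint x y (γ (1 / 2)) := by
  obtain ⟨h0, h1, hd⟩ := h
  constructor
  · have := hd 0 (by norm_num) (1 / 2) (by norm_num)
    rw [h0] at this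
    rw [this]; norm_num; ring
  · have := hd (1 / 2) (by norm_num) 1 (by norm_num)
    rw [h1] at this
    rw [this, abs_of_nonpos] <;> norm_num; ring

/-- Two geodesics of equal length meeting at a metric midpoint form a geodesic. -/
theorem IsMetricMidpoint.exists_geodesic {x y m : X} (hm : IsMetricMidpoint x y m)
    {γ₁ γ₂ : ℝ → X} (h₁ : IsGeodesicFromTo γ₁ x m) (h₂ : IsGeodesicFromTo γ₂ m y) :
    ∃ γ : ℝ → X, IsGeodesicFromTo γ x y ∧ γ (1 / 2) = m := by
  obtain ⟨a0, a1, ad⟩ := h₁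
  obtain ⟨b0, b1, bd⟩ := h₂
  set γ : ℝ → X := fun t => if t ≤ 1 / 2 then γ₁ (2 * t) else γ₂ (2 * t - 1) with hγ
  have hlow : ∀ t, t ≤ 1 / 2 → γ t = γ₁ (2 * t) := fun t ht => if_pos ht
  have hhigh : ∀ t, 1 / 2 ≤ t → γ t = γ₂ (2 * t - 1) := by
    intro t ht
    rcases ht.eq_or_lt with rfl | ht
    · rw [hlow _ le_rfl]; norm_num [a1, b0]
    · exact if_neg (not_le.2 ht)
  have g0 : γ 0 = x := by rw [hlow _ (by norm_num)]; norm_num [a0]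
  have g1 : γ 1 = y := by rw [hhigh _ (by norm_num)]; norm_num [b1]
  have main : ∀ s ∈ Icc (0 : ℝ) 1, ∀ t ∈ Icc (0 : ℝ) 1, s ≤ t →
      dist (γ s) (γ t) = (t - s) * dist x y := by
    intro s hs t ht hst
    have hxm := hm.1
    have hmy := hm.2
    rcases le_total t (1 / 2) with h | h
    · rw [hlow s (hst.trans h), hlow t h, ad _ ⟨by linarith [hs.1], by linarith⟩ _
        ⟨by linarith [hs.1], by linarith⟩, abs_of_nonpos (by linarith), hxm]
      ring
    · rcases le_total s (1 / 2) with h' | h'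
      · have e1 := ad (2 * s) ⟨by linarith [hs.1], by linarith⟩ 1 (by norm_num)
        have e2 := bd 0 (by norm_num) (2 * t - 1) ⟨by linarith, by linarith [ht.2]⟩
        have e3 := ad 0 (by norm_num) (2 * s) ⟨by linarith [hs.1], by linarith⟩
        have e4 := bd (2 * t - 1) ⟨by linarith, by linarith [ht.2]⟩ 1 (by norm_num)
        rw [a1, hxm, abs_of_nonpos (by linarith), ← hlow s h'] at e1
        rw [b0, hmy, abs_of_nonpos (by linarith), ← hhigh t h] at e2
        rw [a0, hxm, abs_of_nonpos (by linarith [hs.1]), ← hlow s h'] at e3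
        rw [b1, hmy, abs_of_nonpos (by linarith [ht.2]), ← hhigh t h] at e4
        -- `t1` bounds the distance above by passing through `m`. `t2` bounds it below, since a
        -- shorter passage would give a path from `x` to `y` shorter than `dist x y`.
        have t1 := dist_triangle (γ s) m (γ t)
        have t2 := dist_triangle4 x (γ s) (γ t) y
        nlinarith
      · rw [hhigh s h', hhigh t h, bd _ ⟨by linarith [hs.1], by linarith [hs.2]⟩ _
          ⟨by linarith [hs.1], by linarith [ht.2]⟩, abs_of_nonpos (by linarith), hmy]
        ring
  refine ⟨γ, ⟨g0, g1, fun s hs t ht => ?_⟩, by rw [hlow _ le_rfl]; norm_num [a1]⟩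
  rcases le_total s t with h | h
  · rw [main s hs t ht h, abs_of_nonpos (by linarith)]; ring
  · rw [dist_comm, main t ht s hs h, abs_of_nonneg (by linarith)]

/-- Every metric midpoint is the time-1/2 point of some geodesic, so convexity at 1/2 applies to
arbitrary midpoints. With equal endpoints it yields uniqueness. -/
theorem IsBusemannSpace.dist_midpoints_le (hX : IsBusemannSpace X) {x y x' y' m m' : X}
    (h : IsMetricMidpoint x y m) (h' : IsMetricMidpoint x' y' m') :
    dist m m' ≤ (dist x x' + dist y y') / 2 := by
  obtain ⟨γ₁, h₁⟩ := hX.exists_geodesic x m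
  obtain ⟨γ₂, h₂⟩ := hX.exists_geodesic m y
  obtain ⟨γ₁', h₁'⟩ := hX.exists_geodesic x' m'
  obtain ⟨γ₂', h₂'⟩ := hX.exists_geodesic m' y'
  obtain ⟨γ, hγ, rfl⟩ := h.exists_geodesic h₁ h₂
  obtain ⟨γ', hγ', rfl⟩ := h'.exists_geodesic h₁' h₂'
  have := (hX.convex_dist γ γ' x y x' y' hγ hγ').2
    (show (0 : ℝ) ∈ Icc (0 : ℝ) 1 by norm_num) (show (1 : ℝ) ∈ Icc (0 : ℝ) 1 by norm_num)
    (show (0 : ℝ) ≤ 1 / 2 by norm_num) (show (0 : ℝ) ≤ 1 / 2 by norm_num) (by norm_num)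
  simp only [smul_eq_mul, mul_zero, mul_one, zero_add, hγ.1, hγ.2.1, hγ'.1, hγ'.2.1] at this
  linarith

theorem IsBusemannSpace.isMetricMidpoint_iff (hX : IsBusemannSpace X) (x y m : X) :
    IsMetricMidpoint x y m ↔ m = metricMidpoint x y := by
  obtain ⟨γ, hγ⟩ := hX.exists_geodesic x y
  have hs : IsMetricMidpoint x y (metricMidpoint x y) :=
    @Classical.epsilon_spec_aux X ⟨x⟩ _ ⟨_, hγ.isMetricMidpoint⟩
  refine ⟨fun h => ?_, fun h => h ▸ hs⟩
  have := hX.dist_midpoints_le h hs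
  rw [dist_self, dist_self] at this
  exact dist_le_zero.1 (by linarith)

end BusemannMidpoint

/-! ### Contracting midpoint maps and symmetric means -/

/-- A midpoint map that is idempotent, symmetric, convex for the metric and canonical. -/
structure ContractingMid {X : Type*} [MetricSpace X] (mid : X → X → X) : Prop where
  self : ∀ x, mid x x = x
  comm : ∀ x y, mid x y = mid y x
  dist_le : ∀ x y x' y', dist (mid x y) (mid x' y') ≤ (dist x x' + dist y y') / 2
  map_isometry : ∀ (f : X ≃ᵢ X) (x y : X), f (mid x y) = mid (f x) (f y)

theorem IsBusemannSpace.contractingMid {X : Type*} [MetricSpace X] (hX : IsBusemannSpace X) :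
    ContractingMid (metricMidpoint : X → X → X) := by
  have hs : ∀ x y : X, IsMetricMidpoint x y (metricMidpoint x y) :=
    fun x y => (hX.isMetricMidpoint_iff x y _).2 rfl
  refine ⟨fun x => ?_, fun x y => ?_, fun x y x' y' => hX.dist_midpoints_le (hs _ _) (hs _ _),
    fun f x y => ?_⟩
  · exact ((hX.isMetricMidpoint_iff x x x).1 (by simp [IsMetricMidpoint])).symm
  · refine (hX.isMetricMidpoint_iff y x _).1 ⟨?_, ?_⟩
    · rw [dist_comm, (hs x y).2, dist_comm x y]
    · rw [dist_comm, (hs x y).1, dist_comm x y]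
  · refine (hX.isMetricMidpoint_iff _ _ _).1 ⟨?_, ?_⟩
    · rw [f.dist_eq, f.dist_eq, (hs x y).1]
    · rw [f.dist_eq, f.dist_eq, (hs x y).2]

theorem contractingMid_midpoint {E : Type*} [NormedAddCommGroup E] [NormedSpace ℝ E] :
    ContractingMid (fun x y : E => midpoint ℝ x y) := by
  -- `f.map_midpoint` is the Mazur–Ulam argument: `f` is not assumed affine.
  refine ⟨midpoint_self ℝ, midpoint_comm, fun x y x' y' => ?_, fun f x y => f.map_midpoint x y⟩
  have := dist_midpoint_midpoint_le' (𝕜 := ℝ) x y x' y'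
  simpa using this

/-- An idempotent, permutation invariant mean of families of `n` points that contracts
the average distance. -/
structure SymmetricMean {X : Type*} [MetricSpace X] {n : ℕ} (f : (Fin n → X) → X) : Prop where
  const : ∀ x, f (fun _ => x) = x
  perm : ∀ (x : Fin n → X) (σ : Equiv.Perm (Fin n)), f (fun j => x (σ j)) = f x
  dist_le : ∀ x y : Fin n → X, n * dist (f x) (f y) ≤ ∑ i, dist (x i) (y i)

namespace SymmetricMean

variable {X : Type*} [MetricSpace X] {n : ℕ} {f : (Fin n → X) → X}

theorem replaceStep_perm (hf : SymmetricMean f) (x : Fin (n + 1) → X)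
    (σ : Equiv.Perm (Fin (n + 1))) :
    replaceStep f (fun j => x (σ j)) = fun i => replaceStep f x (σ i) := by
  funext i
  -- `σ` maps the complement of `i` onto that of `σ i`; numbering both by `Fin n` turns it into a
  -- permutation, which `f` ignores.
  let τ : Equiv.Perm (Fin n) := ((finSuccAboveEquiv i).trans
    (σ.subtypeEquiv (p := fun j => j ≠ i) (q := fun j => j ≠ σ i) (by simp))).trans
      (finSuccAboveEquiv (σ i)).symm
  have hτ : ∀ j, (σ i).succAbove (τ j) = σ (i.succAbove j) := by
    intro j
    have : finSuccAboveEquiv (σ i) (τ j) = (σ.subtypeEquiv (p := fun j => j ≠ i)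
      (q := fun j => j ≠ σ i) (by simp)) (finSuccAboveEquiv i j) :=
      (finSuccAboveEquiv (σ i)).apply_symm_apply _
    exact congrArg Subtype.val this
  simp only [replaceStep, ← hτ]
  exact hf.perm (fun j => x ((σ i).succAbove j)) τ

/-- Double counting: each index occurs in exactly `n` of the `n + 1` subfamilies. -/
theorem sum_dist_replaceStep_le (hf : SymmetricMean f) (hn : 0 < n) (x y : Fin (n + 1) → X) :
    ∑ i, dist (replaceStep f x i) (replaceStep f y i) ≤ ∑ i, dist (x i) (y i) := by
  have hn' : (0 : ℝ) < n := by exact_mod_cast hn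
  refine le_of_mul_le_mul_left ?_ hn'
  calc (n : ℝ) * ∑ i, dist (replaceStep f x i) (replaceStep f y i)
      = ∑ i, n * dist (replaceStep f x i) (replaceStep f y i) := Finset.mul_sum _ _ _
    _ ≤ ∑ i : Fin (n + 1), ∑ j, dist (x (i.succAbove j)) (y (i.succAbove j)) :=
        Finset.sum_le_sum fun i _ => hf.dist_le _ _
    _ = ∑ i : Fin (n + 1), ((∑ j, dist (x j) (y j)) - dist (x i) (y i)) := by
        refine Finset.sum_congr rfl fun i _ => ?_
        rw [Fin.sum_univ_succAbove (fun j => dist (x j) (y j)) i]; ring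
    _ = n * ∑ i, dist (x i) (y i) := by
        rw [Finset.sum_sub_distrib]; simp; ring

/-- Up to order, the families omitting `i` and omitting `j` differ in a single entry, `x j` against
`x i`. -/
theorem dist_replaceStep_replaceStep_le (hf : SymmetricMean f) (x : Fin (n + 1) → X)
    (i j : Fin (n + 1)) :
    n * dist (replaceStep f x i) (replaceStep f x j) ≤ dist (x i) (x j) := by
  rcases eq_or_ne i j with rfl | hij
  · simp
  have h := congrFun (hf.replaceStep_perm x (Equiv.swap i j)) i
  rw [Equiv.swap_apply_left] at h
  rw [← h]
  refine (hf.dist_le _ _).trans ?_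
  have e := Fin.sum_univ_succAbove (fun k => dist (x k) (x (Equiv.swap i j k))) i
  have e2 : ∑ k, dist (x k) (x (Equiv.swap i j k)) = dist (x i) (x j) + dist (x j) (x i) := by
    rw [← Finset.sum_subset (Finset.subset_univ {i, j}), Finset.sum_pair hij]
    · simp
    · intro k _ hk
      simp only [Finset.mem_insert, Finset.mem_singleton, not_or] at hk
      rw [Equiv.swap_apply_of_ne_of_ne hk.1 hk.2, dist_self]
  rw [e2, Equiv.swap_apply_left, dist_comm (x j)] at e
  linarith

theorem dist_replaceStep_self_le (hf : SymmetricMean f) (hn : 0 < n) (x : Fin (n + 1) → X)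
    (C : ℝ) (hC : ∀ i j, dist (x i) (x j) ≤ C) (i : Fin (n + 1)) :
    dist (replaceStep f x i) (x i) ≤ C := by
  have hn' : (0 : ℝ) < n := by exact_mod_cast hn
  refine le_of_mul_le_mul_left ?_ hn'
  have h := hf.dist_le (fun j => x (i.succAbove j)) (fun _ => x i)
  rw [hf.const] at h
  refine h.trans ((Finset.sum_le_sum fun j _ => hC _ _).trans ?_)
  simp

theorem dist_iterate_le (hf : SymmetricMean f) (hn : 2 ≤ n) (x : Fin (n + 1) → X)
    (i j : Fin (n + 1)) (k : ℕ) :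
    dist ((replaceStep f)^[k] x i) ((replaceStep f)^[k] x j) ≤ dist (x i) (x j) * (1 / 2) ^ k := by
  induction k with
  | zero => simp
  | succ k ih =>
    rw [Function.iterate_succ_apply']
    have h := hf.dist_replaceStep_replaceStep_le ((replaceStep f)^[k] x) i j
    have hn' : (2 : ℝ) ≤ n := by exact_mod_cast hn
    have := mul_le_mul_of_nonneg_right hn' (dist_nonneg (x := replaceStep f ((replaceStep f)^[k] x) i)
      (y := replaceStep f ((replaceStep f)^[k] x) j))
    rw [pow_succ]
    linarith

/-- Each entry moves by at most the current diameter, which is at least halved at every step. For `n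
= 1` the step would merely swap two points. -/
theorem exists_tendsto_iterate [CompleteSpace X] (hf : SymmetricMean f) (hn : 2 ≤ n)
    (x : Fin (n + 1) → X) :
    ∃ p, ∀ i, Tendsto (fun k : ℕ => (replaceStep f)^[k] x i) atTop (𝓝 p) := by
  obtain ⟨C, hC⟩ : ∃ C, ∀ i j, dist (x i) (x j) ≤ C :=
    ⟨Metric.diam (range x), fun i j => Metric.dist_le_diam_of_mem (finite_range x).isBounded
      (mem_range_self i) (mem_range_self j)⟩
  have hdiam : ∀ k i j, dist ((replaceStep f)^[k] x i) ((replaceStep f)^[k] x j)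
      ≤ C * (1 / 2) ^ k := fun k i j =>
    (hf.dist_iterate_le hn x i j k).trans (mul_le_mul_of_nonneg_right (hC i j) (by positivity))
  have hc : ∀ i, CauchySeq fun k : ℕ => (replaceStep f)^[k] x i := fun i => by
    refine cauchySeq_of_le_geometric (1 / 2) C (by norm_num) fun k => ?_
    rw [Function.iterate_succ_apply', dist_comm]
    exact hf.dist_replaceStep_self_le (by omega) _ _ (hdiam k) i
  obtain ⟨p, hp⟩ := cauchySeq_tendsto_of_complete (hc 0)
  refine ⟨p, fun i => tendsto_iff_dist_tendsto_zero.2 ?_⟩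
  have h1 := tendsto_iff_dist_tendsto_zero.1 hp
  have h2 : Tendsto (fun k : ℕ => C * (1 / 2 : ℝ) ^ k) atTop (𝓝 0) := by
    simpa using (tendsto_pow_atTop_nhds_zero_of_lt_one (r := (1 / 2 : ℝ)) (by norm_num)
      (by norm_num)).const_mul C
  refine squeeze_zero (fun _ => dist_nonneg) (fun k => ?_) (by simpa only [add_zero] using h2.add h1)
  exact (dist_triangle _ ((replaceStep f)^[k] x 0) p).trans (by gcongr; exact hdiam k i 0)

/-- The sum of distances does not increase along the iteration. Since all entries share one limit,
it converges to `n + 1` times the distance of the limits. -/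
theorem of_tendsto (hf : SymmetricMean f) (hn : 0 < n) {F : (Fin (n + 1) → X) → X}
    (hF : ∀ x i, Tendsto (fun k : ℕ => (replaceStep f)^[k] x i) atTop (𝓝 (F x))) :
    SymmetricMean F := by
  refine ⟨fun x => ?_, fun x σ => ?_, fun x y => ?_⟩
  · have h : ∀ k : ℕ, (replaceStep f)^[k] (fun _ => x) = fun _ => x := fun k =>
      Function.iterate_fixed (funext fun _ => hf.const x) k
    have := hF (fun _ => x) 0
    simp only [h] at this
    exact (tendsto_nhds_unique this tendsto_const_nhds)
  · have h : ∀ k : ℕ, (replaceStep f)^[k] (fun j => x (σ j))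
        = fun i => (replaceStep f)^[k] x (σ i) := by
      intro k
      induction k with
      | zero => rfl
      | succ k ih => rw [Function.iterate_succ_apply', Function.iterate_succ_apply', ih,
          hf.replaceStep_perm]
    have h1 := hF (fun j => x (σ j)) 0
    simp only [h] at h1
    exact tendsto_nhds_unique h1 (hF x (σ 0))
  · have h : ∀ k : ℕ, ∑ i, dist ((replaceStep f)^[k] x i) ((replaceStep f)^[k] y i)
        ≤ ∑ i, dist (x i) (y i) := by
      intro k
      induction k with
      | zero => rfl
      | succ k ih =>
        rw [Function.iterate_succ_apply', Function.iterate_succ_apply']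
        exact (hf.sum_dist_replaceStep_le hn _ _).trans ih
    have h1 := tendsto_finsetSum Finset.univ fun i _ => (hF x i).dist (hF y i)
    have := le_of_tendsto' h1 h
    simpa using this

theorem of_mid {mid : X → X → X} (h : ContractingMid mid) :
    SymmetricMean (fun x : Fin 2 → X => mid (x 0) (x 1)) := by
  refine ⟨fun x => h.self x, fun x σ => ?_, fun x y => ?_⟩
  · have : ∀ σ : Equiv.Perm (Fin 2), (σ 0 = 0 ∧ σ 1 = 1) ∨ (σ 0 = 1 ∧ σ 1 = 0) := by decide
    rcases this σ with h' | h'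
    · simp only [h'.1, h'.2]
    · simp only [h'.1, h'.2]; exact h.comm _ _
  · have := h.dist_le (x 0) (x 1) (y 0) (y 1)
    simp only [Fin.sum_univ_two, Nat.cast_ofNat]
    linarith

end SymmetricMean

/-! ### The iterated barycenters -/

namespace ContractingMid

variable {X : Type*} [MetricSpace X] [CompleteSpace X] [Nonempty X] {mid : X → X → X}

theorem symmetricMean_and_tendsto (h : ContractingMid mid) (n : ℕ) :
    SymmetricMean (iterBar mid (n + 2)) ∧ ∀ (x : Fin (n + 3) → X) (i : Fin (n + 3)),
      Tendsto (fun k : ℕ => ((replaceStep (iterBar mid (n + 2)))^[k] x) i) atTop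
        (𝓝 (iterBar mid (n + 3) x)) := by
  have key : ∀ n, SymmetricMean (iterBar mid (n + 2)) → ∀ (x : Fin (n + 3) → X) (i : Fin (n + 3)),
      Tendsto (fun k : ℕ => ((replaceStep (iterBar mid (n + 2)))^[k] x) i) atTop
        (𝓝 (iterBar mid (n + 3) x)) := by
    intro n hf x i
    obtain ⟨p, hp⟩ := hf.exists_tendsto_iterate (by omega) x
    have : iterBar mid (n + 3) x = p := by
      rw [iterBar]; exact (hp 0).limUnder_eq
    rw [this]
    exact hp i
  induction n with
  | zero =>
    have h2 : SymmetricMean (iterBar mid 2) := SymmetricMean.of_mid h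
    exact ⟨h2, key 0 h2⟩
  | succ n ih =>
    have h2 : SymmetricMean (iterBar mid (n + 3)) := ih.1.of_tendsto (by omega) ih.2
    exact ⟨h2, key (n + 1) h2⟩

theorem symmetricMean (h : ContractingMid mid) (n : ℕ) :
    SymmetricMean (iterBar mid (n + 1)) := by
  cases n with
  | zero =>
    refine ⟨fun x => rfl, fun x σ => ?_, fun x y => ?_⟩
    · exact congrArg x (Subsingleton.elim (α := Fin 1) (σ 0) 0)
    · simp [iterBar]
  | succ n => exact (h.symmetricMean_and_tendsto n).1

/-- One step only shifts the defining sequence; on two points it is a swap. This invariance drives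
the monotonicity of `meanDist`. -/
theorem iterBar_replaceStep (h : ContractingMid mid) (n : ℕ) (x : Fin (n + 2) → X) :
    iterBar mid (n + 2) (replaceStep (iterBar mid (n + 1)) x) = iterBar mid (n + 2) x := by
  cases n with
  | zero =>
    simp only [iterBar, replaceStep]
    exact h.comm _ _
  | succ n =>
    refine tendsto_nhds_unique ((h.symmetricMean_and_tendsto n).2 _ 0) ?_
    simp only [← Function.iterate_succ_apply]
    exact ((h.symmetricMean_and_tendsto n).2 x 0).comp (tendsto_add_atTop_nat 1)

theorem map_iterBar (h : ContractingMid mid) (f : X ≃ᵢ X) (n : ℕ) (x : Fin (n + 1) → X) :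
    f (iterBar mid (n + 1) x) = iterBar mid (n + 1) (fun i => f (x i)) := by
  cases n with
  | zero => rfl
  | succ n =>
    induction n with
    | zero => exact h.map_isometry f _ _
    | succ n ih =>
      have hk : ∀ k : ℕ, (replaceStep (iterBar mid (n + 2)))^[k] (fun i => f (x i))
          = fun i => f ((replaceStep (iterBar mid (n + 2)))^[k] x i) := by
        intro k
        induction k with
        | zero => rfl
        | succ k ihk =>
          rw [Function.iterate_succ_apply', Function.iterate_succ_apply', ihk]
          funext i
          exact (ih _).symm
      have h1 := (h.symmetricMean_and_tendsto n).2 (fun i => f (x i)) 0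
      simp only [hk] at h1
      exact tendsto_nhds_unique
        ((f.continuous.tendsto _).comp ((h.symmetricMean_and_tendsto n).2 x 0)) h1

end ContractingMid

/-! ### Matching two families of labels -/

/-- Two families of labels agree, after a permutation, up to the difference of their counts. -/
theorem exists_perm_card_mismatch_le {α ι : Type*} [Fintype α] [Fintype ι] [DecidableEq ι]
    (l l' : α → ι) : ∃ σ : Equiv.Perm α,
      ((Finset.univ.filter fun j => l j ≠ l' (σ j)).card : ℝ) ≤
        ∑ i, |((Finset.univ.filter fun j => l j = i).card : ℝ)
          - (Finset.univ.filter fun j => l' j = i).card| := by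
  classical
  obtain ⟨σ, -, hσ⟩ := Finset.exists_min_image (Finset.univ : Finset (Equiv.Perm α))
    (fun σ => (Finset.univ.filter fun j => l j ≠ l' (σ j)).card) ⟨1, Finset.mem_univ _⟩
  -- For a permutation with fewest mismatches, no label is unmatched on both sides: swapping `j` and
  -- `j'` would repair position `j` and spoil nothing.
  have hno : ∀ i j j', l j = i → l' (σ j) ≠ i → l j' ≠ i → l' (σ j') = i → False := by
    intro i j j' h1 h2 h3 h4
    refine absurd (hσ (σ * Equiv.swap j j') (Finset.mem_univ _)) (not_le.2 ?_)
    refine Finset.card_lt_card ((Finset.ssubset_iff_of_subset ?_).2 ⟨j, ?_, ?_⟩)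
    · intro k hk
      replace hk : l k ≠ l' (σ (Equiv.swap j j' k)) := (Finset.mem_filter.1 hk).2
      refine Finset.mem_filter.2 ⟨Finset.mem_univ _, ?_⟩
      rcases eq_or_ne k j with rfl | hkj
      · rw [Equiv.swap_apply_left, h4] at hk
        exact absurd h1 hk
      rcases eq_or_ne k j' with rfl | hkj'
      · rwa [h4]
      rwa [Equiv.swap_apply_of_ne_of_ne hkj hkj'] at hk
    · simpa [h1] using h2.symm
    · intro hk
      have hk' : l j ≠ l' (σ (Equiv.swap j j' j)) := (Finset.mem_filter.1 hk).2
      rw [Equiv.swap_apply_left, h4] at hk'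
      exact hk' h1
  refine ⟨σ, ?_⟩
  rw [Finset.card_eq_sum_card_fiberwise (f := l) (t := Finset.univ) (fun _ _ => by simp)]
  push_cast
  refine Finset.sum_le_sum fun i _ => ?_
  have hc' : (Finset.univ.filter fun j => l' j = i).card
      = (Finset.univ.filter fun j => l' (σ j) = i).card := by
    refine Eq.trans (congrArg Finset.card ?_) (Finset.card_map σ.toEmbedding)
    ext j
    simp only [Finset.mem_filter, Finset.mem_univ, true_and, Finset.mem_map_equiv,
      Equiv.apply_symm_apply]
  have s1 := Finset.card_filter_add_card_filter_not (s := Finset.univ.filter fun j => l j = i)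
    (fun j => l' (σ j) = i)
  have s2 := Finset.card_filter_add_card_filter_not
    (s := Finset.univ.filter fun j => l' (σ j) = i) (fun j => l j = i)
  rw [Finset.filter_filter, Finset.filter_filter] at s1 s2
  have hA : ((Finset.univ.filter fun j => l j ≠ l' (σ j)).filter fun j => l j = i)
      = Finset.univ.filter fun j => l j = i ∧ ¬ l' (σ j) = i := by
    rw [Finset.filter_filter]
    refine Finset.filter_congr fun j _ => ?_
    constructor
    · rintro ⟨h1, rfl⟩; exact ⟨rfl, fun h => h1 h.symm⟩
    · rintro ⟨rfl, h1⟩; exact ⟨fun h => h1 h.symm, rfl⟩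
  have hcomm : (Finset.univ.filter fun j => l' (σ j) = i ∧ l j = i)
      = Finset.univ.filter fun j => l j = i ∧ l' (σ j) = i :=
    Finset.filter_congr fun j _ => and_comm
  rw [hA, hc', ← s1, ← s2, hcomm]
  push_cast
  -- By `hno`, one of the two set differences is empty, so a nonempty first one has size exactly the
  -- difference of the counts.
  rcases (Finset.univ.filter fun j => l j = i ∧ ¬ l' (σ j) = i).eq_empty_or_nonempty with h | ⟨j, hj⟩
  · rw [h]; simp
  · have : (Finset.univ.filter fun j => l' (σ j) = i ∧ ¬ l j = i) = ∅ := by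
      refine Finset.filter_eq_empty_iff.2 fun j' _ hj' => ?_
      simp only [Finset.mem_filter, Finset.mem_univ, true_and] at hj
      exact hno i j j' hj.1 hj.2 hj'.2 hj'.1
    rw [this]
    simp

/-! ### Fluctuations of label counts -/

section Counts

variable {ι : Type*} [Fintype ι] [DecidableEq ι] [MeasurableSpace ι] [MeasurableSingletonClass ι]

/-- The number of entries with label `i` in a sample of `N` independent labels deviates from its
mean by at most `√N` on average. -/
theorem integral_abs_count_sub_le (ρ : Measure ι) [IsProbabilityMeasure ρ] (N : ℕ) (i : ι) :
    ∫ l, |((Finset.univ.filter fun j => l j = i).card : ℝ) - N * ρ.real {i}|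
      ∂(Measure.pi fun _ : Fin N => ρ) ≤ √N := by
  rcases N.eq_zero_or_pos with rfl | hN
  · simp
  have hN' : (0 : ℝ) < N := by exact_mod_cast hN
  set P := Measure.pi fun _ : Fin N => ρ with hP
  set Y : ι → ℝ := fun t => if t = i then 1 else 0 with hY
  have hcount : (∑ j : Fin N, fun l : Fin N → ι => Y (l j))
      = fun l => ((Finset.univ.filter fun j => l j = i).card : ℝ) := by
    funext l
    simp [hY]
  have hmean1 : ∫ t, Y t ∂ρ = ρ.real {i} := by
    have : Y = Set.indicator {i} (fun _ => (1 : ℝ)) := by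
      funext t; simp [hY, Set.indicator_apply]
    rw [this, integral_indicator_const _ (measurableSet_singleton i)]; simp
  have hmean : ∫ l, ((Finset.univ.filter fun j => l j = i).card : ℝ) ∂P = N * ρ.real {i} := by
    have hcount' : ∀ l : Fin N → ι,
        ((Finset.univ.filter fun j => l j = i).card : ℝ) = ∑ j, Y (l j) := fun l => by simp [hY]
    simp only [hcount']
    rw [integral_finsetSum _ fun _ _ => Integrable.of_finite]
    have : ∀ j : Fin N, ∫ l, Y (l j) ∂P = ρ.real {i} := fun j => by
      rw [← hmean1]
      have h := measurePreserving_eval (fun _ : Fin N => ρ) j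
      rw [← h.map_eq, integral_map h.measurable.aemeasurable
        (Measurable.of_discrete).aestronglyMeasurable]
    simp [this]
  have hvar : ∫ l, (((Finset.univ.filter fun j => l j = i).card : ℝ) - N * ρ.real {i}) ^ 2 ∂P
      ≤ N := by
    rw [← hmean, ← ProbabilityTheory.variance_eq_integral
      (Measurable.of_discrete).aemeasurable, ← hcount,
      ProbabilityTheory.variance_sum_pi (X := fun _ => Y) fun _ => MemLp.of_discrete]
    have : ProbabilityTheory.variance Y ρ ≤ 1 := by
      refine (ProbabilityTheory.variance_le_sq_of_bounded (a := 0) (b := 1)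
        (Eventually.of_forall fun t => ?_) (Measurable.of_discrete).aemeasurable).trans (by norm_num)
      by_cases h : t = i <;> simp [hY, h]
    calc _ ≤ ∑ _j : Fin N, (1 : ℝ) := Finset.sum_le_sum fun _ _ => this
      _ = N := by simp
  have hs : (0 : ℝ) < √N := Real.sqrt_pos.2 hN'
  have hss : √N * √N = N := Real.mul_self_sqrt hN'.le
  refine le_of_mul_le_mul_left ?_ (mul_pos two_pos hs)
  rw [← integral_const_mul]
  -- From the variance to the first moment by `2√N |t| ≤ t² + N`.
  calc _ ≤ ∫ l, ((((Finset.univ.filter fun j => l j = i).card : ℝ) - N * ρ.real {i}) ^ 2 + N) ∂P := by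
        refine integral_mono Integrable.of_finite Integrable.of_finite fun l => ?_
        have := sq_nonneg (|((Finset.univ.filter fun j => l j = i).card : ℝ) - N * ρ.real {i}| - √N)
        rw [sub_sq, sq_abs, sq (√N), hss] at this
        simp only
        linarith
    _ ≤ 2 * √N * √N := by
        rw [integral_add Integrable.of_finite Integrable.of_finite]
        simp only [integral_const, probReal_univ, smul_eq_mul]
        linarith

end Counts

/-! ### Metric estimates for symmetric means -/

namespace SymmetricMean

variable {X : Type*} [MetricSpace X] {n : ℕ} {f : (Fin n → X) → X}

theorem edist_le (hf : SymmetricMean f) (hn : 0 < n) (x y : Fin n → X) :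
    edist (f x) (f y) ≤ (n : ℝ≥0∞)⁻¹ * ∑ i, edist (x i) (y i) := by
  have hn' : (n : ℝ≥0∞) ≠ 0 := by exact_mod_cast hn.ne'
  rw [mul_comm, ← div_eq_mul_inv, ENNReal.le_div_iff_mul_le (Or.inl hn')
    (Or.inl (ENNReal.natCast_ne_top n)), mul_comm]
  simp only [edist_dist]
  rw [← ENNReal.ofReal_sum_of_nonneg fun _ _ => dist_nonneg, ← ENNReal.ofReal_natCast,
    ← ENNReal.ofReal_mul (Nat.cast_nonneg n)]
  exact ENNReal.ofReal_le_ofReal (hf.dist_le x y)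

theorem continuous (hf : SymmetricMean f) (hn : 0 < n) : Continuous f := by
  refine (LipschitzWith.of_dist_le_mul (K := 1) fun x y => ?_).continuous
  have hn' : (0 : ℝ) < n := by exact_mod_cast hn
  refine le_of_mul_le_mul_left ?_ hn'
  refine (hf.dist_le x y).trans ((Finset.sum_le_sum fun i _ => dist_le_pi_dist x y i).trans ?_)
  simp

/-- After an optimal reordering only mismatched positions contribute, each at most `D`. Thus the
mean is controlled by label counts alone. -/
theorem dist_comp_le {ι : Type*} [Fintype ι] [DecidableEq ι] (hf : SymmetricMean f)
    (y : ι → X) (D : ℝ) (hD : ∀ i j, dist (y i) (y j) ≤ D) (l l' : Fin n → ι) :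
    n * dist (f fun j => y (l j)) (f fun j => y (l' j)) ≤
      D * ∑ i, |((Finset.univ.filter fun j => l j = i).card : ℝ)
          - (Finset.univ.filter fun j => l' j = i).card| := by
  obtain ⟨σ, hσ⟩ := exists_perm_card_mismatch_le l l'
  rcases n.eq_zero_or_pos with rfl | hn
  · simp
  have hD0 : 0 ≤ D := dist_nonneg.trans (hD (l ⟨0, hn⟩) (l ⟨0, hn⟩))
  rw [← hf.perm (fun j => y (l' j)) σ]
  refine (hf.dist_le _ _).trans (le_trans ?_ (mul_le_mul_of_nonneg_left hσ hD0))
  rw [mul_comm, ← nsmul_eq_mul, ← Finset.sum_const, Finset.sum_filter]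
  refine Finset.sum_le_sum fun j _ => ?_
  by_cases h : l j = l' (σ j)
  · simp [h]
  · simpa [h] using hD _ _

end SymmetricMean

/-! ### The mean distance from a point to the barycenter of a random sample -/

/-- The mean distance from `z` to the barycenter of `N` independent points of law `μ`. -/
noncomputable def meanDist {X : Type*} [MetricSpace X] [MeasurableSpace X] [Nonempty X]
    (mid : X → X → X) (μ : Measure X) (N : ℕ) (z : X) : ℝ≥0∞ :=
  ∫⁻ x, edist z (iterBar mid N x) ∂(Measure.pi fun _ : Fin N => μ)

theorem meanDist_le_edist_add {X : Type*} [MetricSpace X] [MeasurableSpace X] [Nonempty X]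
    (mid : X → X → X) (μ : Measure X) [IsProbabilityMeasure μ]
    (N : ℕ) (z w : X) :
    meanDist mid μ N z ≤ edist z w + meanDist mid μ N w := by
  calc meanDist mid μ N z
      ≤ ∫⁻ x, (edist z w + edist w (iterBar mid N x)) ∂(Measure.pi fun _ : Fin N => μ) :=
        lintegral_mono fun x => edist_triangle _ _ _
    _ = _ := by rw [lintegral_add_left measurable_const]; simp [meanDist]

theorem P1.exists_simpleFunc_lintegral_edist_lt {X : Type*} [MetricSpace X]
    [SecondCountableTopology X] [Nonempty X] [MeasurableSpace X] [BorelSpace X]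
    (μ : P1 X) {ε : ℝ≥0∞} (hε : 0 < ε) :
    ∃ g : SimpleFunc X X, ∫⁻ x, edist x (g x) ∂μ.1 < ε := by
  let y₀ : X := Classical.arbitrary X
  let g : ℕ → SimpleFunc X X := SimpleFunc.approxOn id measurable_id univ y₀ (mem_univ _)
  have hg : ∀ x, Tendsto (fun n => g n x) atTop (𝓝 x) := fun x =>
    SimpleFunc.tendsto_approxOn measurable_id (mem_univ y₀) (by simp)
  have hb : ∀ n x, edist x (g n x) ≤ edist y₀ x + (edist y₀ x + edist y₀ x) := fun n x => by
    refine (edist_triangle x y₀ _).trans ?_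
    rw [edist_comm x y₀]
    gcongr
    exact SimpleFunc.edist_approxOn_y0_le measurable_id (mem_univ y₀) x n
  have ht : Tendsto (fun n => ∫⁻ x, edist x (g n x) ∂μ.1) atTop (𝓝 (∫⁻ _, 0 ∂μ.1)) := by
    refine tendsto_lintegral_of_dominated_convergence
      (fun x => edist y₀ x + (edist y₀ x + edist y₀ x))
      (fun n => measurable_id.edist (g n).measurable) (fun n => Eventually.of_forall (hb n)) ?_
      (Eventually.of_forall fun x => ?_)
    · have hm : Measurable fun x : X => edist y₀ x := measurable_edist_right
      rw [lintegral_add_left hm, lintegral_add_left hm]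
      have := (μ.2.2 y₀).ne
      simp [this]
    · have := (tendsto_const_nhds (x := x)).edist (hg x)
      rwa [edist_self] at this
  rw [lintegral_zero] at ht
  obtain ⟨n, hn⟩ := ((tendsto_order.1 ht).2 ε hε).exists
  exact ⟨g n, hn⟩

namespace ContractingMid

variable {X : Type*} [MetricSpace X] [CompleteSpace X] [Nonempty X] [MeasurableSpace X]
  [BorelSpace X] [SecondCountableTopology X] {mid : X → X → X}

theorem measurable_iterBar (h : ContractingMid mid) (n : ℕ) :
    Measurable (iterBar mid (n + 1)) :=
  ((h.symmetricMean n).continuous n.succ_pos).measurable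

theorem measurable_edist_iterBar (h : ContractingMid mid) (n : ℕ) (z : X) :
    Measurable fun x : Fin (n + 1) → X => edist z (iterBar mid (n + 1) x) :=
  measurable_const.edist (h.measurable_iterBar n)

/-- By `iterBar_replaceStep` and contraction, the distance from `z` to the barycenter is at most the
average over subfamilies omitting one point. Each subfamily is again an independent sample of law
`μ`. -/
theorem meanDist_succ_le (h : ContractingMid mid) (μ : Measure X) [IsProbabilityMeasure μ]
    (n : ℕ) (z : X) : meanDist mid μ (n + 2) z ≤ meanDist mid μ (n + 1) z := by
  have hmp : ∀ i : Fin (n + 2), MeasurePreserving (fun x (j : Fin (n + 1)) => x (i.succAbove j))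
      (Measure.pi fun _ : Fin (n + 2) => μ) (Measure.pi fun _ : Fin (n + 1) => μ) := fun i =>
    measurePreserving_snd.comp (measurePreserving_piFinSuccAbove (fun _ : Fin (n + 2) => μ) i)
  have hz : ∀ x : Fin (n + 2) → X, edist z (iterBar mid (n + 2) x) ≤ ((n + 2 : ℕ) : ℝ≥0∞)⁻¹ *
      ∑ i : Fin (n + 2), edist z (iterBar mid (n + 1) fun j => x (i.succAbove j)) := fun x => by
    have := (h.symmetricMean (n + 1)).edist_le (by omega) (fun _ => z)
      (replaceStep (iterBar mid (n + 1)) x)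
    rwa [h.iterBar_replaceStep, (h.symmetricMean (n + 1)).const] at this
  refine (lintegral_mono hz).trans ?_
  have hm : ∀ i : Fin (n + 2), Measurable fun x : Fin (n + 2) → X =>
      edist z (iterBar mid (n + 1) fun j => x (i.succAbove j)) := fun i =>
    (h.measurable_edist_iterBar n z).comp (hmp i).measurable
  rw [lintegral_const_mul _ (Finset.measurable_fun_sum _ fun i _ => hm i),
    lintegral_finsetSum _ fun i _ => hm i]
  have he : ∀ i : Fin (n + 2), ∫⁻ x, edist z (iterBar mid (n + 1) fun j => x (i.succAbove j))
      ∂(Measure.pi fun _ : Fin (n + 2) => μ) = meanDist mid μ (n + 1) z := fun i =>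
    (hmp i).lintegral_comp (h.measurable_edist_iterBar n z)
  simp only [he, Finset.sum_const, Finset.card_univ, Fintype.card_fin, nsmul_eq_mul]
  rw [← mul_assoc, ENNReal.inv_mul_cancel (by simp) (ENNReal.natCast_ne_top _), one_mul]

theorem meanDist_antitone (h : ContractingMid mid) (μ : Measure X) [IsProbabilityMeasure μ]
    (z : X) : Antitone fun n => meanDist mid μ (n + 1) z :=
  antitone_nat_of_succ_le fun n => h.meanDist_succ_le μ n z

theorem edist_le_meanDist_add (h : ContractingMid mid) (μ : Measure X) [IsProbabilityMeasure μ]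
    (n : ℕ) (z w : X) : edist z w ≤ meanDist mid μ (n + 1) z + meanDist mid μ (n + 1) w := by
  rw [meanDist, meanDist, ← lintegral_add_left (h.measurable_edist_iterBar n z)]
  calc edist z w = ∫⁻ _, edist z w ∂(Measure.pi fun _ : Fin (n + 1) => μ) := by simp
    _ ≤ _ := lintegral_mono fun x => edist_triangle_right _ _ _

/-- A coupling changes the mean distance by at most its transport cost. -/
theorem meanDist_le_add_of_coupling (h : ContractingMid mid) (π : Measure (X × X))
    [IsProbabilityMeasure π] (n : ℕ) (z : X) :
    meanDist mid (π.map Prod.fst) (n + 1) z ≤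
      meanDist mid (π.map Prod.snd) (n + 1) z + ∫⁻ p, edist p.1 p.2 ∂π := by
  have := Measure.isProbabilityMeasure_map (μ := π) measurable_fst.aemeasurable
  have := Measure.isProbabilityMeasure_map (μ := π) measurable_snd.aemeasurable
  -- Independent pairs of law `π` couple the two samples; each pair costs the transport cost on
  -- average.
  set P := Measure.pi fun _ : Fin (n + 1) => π with hP
  have m1 : MeasurePreserving (fun p (j : Fin (n + 1)) => (p j).1) P
      (Measure.pi fun _ => π.map Prod.fst) :=
    measurePreserving_pi _ _ fun _ => ⟨measurable_fst, rfl⟩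
  have m2 : MeasurePreserving (fun p (j : Fin (n + 1)) => (p j).2) P
      (Measure.pi fun _ => π.map Prod.snd) :=
    measurePreserving_pi _ _ fun _ => ⟨measurable_snd, rfl⟩
  have hd : Measurable fun p : X × X => edist p.1 p.2 := measurable_fst.edist measurable_snd
  have hj : ∀ j : Fin (n + 1), ∫⁻ p : Fin (n + 1) → X × X, edist (p j).1 (p j).2 ∂P
      = ∫⁻ p, edist p.1 p.2 ∂π := fun j =>
    (measurePreserving_eval (fun _ : Fin (n + 1) => π) j).lintegral_comp hd
  have hjm : ∀ j : Fin (n + 1), Measurable fun p : Fin (n + 1) → X × X => edist (p j).1 (p j).2 :=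
    fun j => hd.comp (measurable_pi_apply j)
  have hzm : Measurable fun p : Fin (n + 1) → X × X =>
      edist z (iterBar mid (n + 1) fun j => (p j).2) :=
    (h.measurable_edist_iterBar n z).comp m2.measurable
  rw [meanDist, ← m1.lintegral_comp (h.measurable_edist_iterBar n z), meanDist,
    ← m2.lintegral_comp (h.measurable_edist_iterBar n z)]
  calc _ ≤ ∫⁻ p : Fin (n + 1) → X × X, (edist z (iterBar mid (n + 1) fun j => (p j).2) +
          ((n + 1 : ℕ) : ℝ≥0∞)⁻¹ * ∑ j, edist (p j).1 (p j).2) ∂P := by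
        refine lintegral_mono fun p => (edist_triangle_right _ _
          (iterBar mid (n + 1) fun j => (p j).2)).trans ?_
        gcongr
        exact (h.symmetricMean n).edist_le n.succ_pos _ _
    _ = _ := by
        rw [lintegral_add_left hzm,
          lintegral_const_mul _ (Finset.measurable_fun_sum _ fun j _ => hjm j),
          lintegral_finsetSum _ fun j _ => hjm j]
        simp only [hj, Finset.sum_const, Finset.card_univ, Fintype.card_fin, nsmul_eq_mul]
        rw [← mul_assoc, ENNReal.inv_mul_cancel (by simp) (ENNReal.natCast_ne_top _), one_mul]

theorem meanDist_map (h : ContractingMid mid) {ι : Type*} [MeasurableSpace ι] (ρ : Measure ι)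
    [IsProbabilityMeasure ρ] {y : ι → X} (hy : Measurable y) (n : ℕ) (z : X) :
    meanDist mid (ρ.map y) (n + 1) z = ∫⁻ l, edist z (iterBar mid (n + 1) fun j => y (l j))
      ∂(Measure.pi fun _ : Fin (n + 1) => ρ) := by
  have := Measure.isProbabilityMeasure_map (μ := ρ) hy.aemeasurable
  have m : MeasurePreserving (fun l (j : Fin (n + 1)) => y (l j)) (Measure.pi fun _ => ρ)
      (Measure.pi fun _ => ρ.map y) := measurePreserving_pi _ _ fun _ => ⟨hy, rfl⟩
  exact (m.lintegral_comp (h.measurable_edist_iterBar n z)).symm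

/-! ### Laws with finitely many labelled atoms: mean distance of order `1/√N`. -/

section FiniteLabels

variable {ι : Type*} [Fintype ι] [DecidableEq ι] [MeasurableSpace ι] [MeasurableSingletonClass ι]

/-- The counts of the fixed family `l'` and of a random family are compared through the expected
counts; the random deviation averages to at most `√N` per label. -/
theorem meanDist_map_le (h : ContractingMid mid) (ρ : Measure ι) [IsProbabilityMeasure ρ]
    (y : ι → X) (D : ℝ) (hD : ∀ i j, dist (y i) (y j) ≤ D) (n : ℕ) (l' : Fin (n + 1) → ι) :
    meanDist mid (ρ.map y) (n + 1) (iterBar mid (n + 1) fun j => y (l' j)) ≤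
      ENNReal.ofReal (D / (n + 1 : ℕ) *
        (∑ i, |((Finset.univ.filter fun j => l' j = i).card : ℝ) - (n + 1 : ℕ) * ρ.real {i}|
          + Fintype.card ι * √(n + 1 : ℕ))) := by
  have hn : (0 : ℝ) < (n + 1 : ℕ) := by exact_mod_cast n.succ_pos
  have hD0 : 0 ≤ D := dist_nonneg.trans (hD (l' 0) (l' 0))
  rw [h.meanDist_map ρ Measurable.of_discrete]
  set P := Measure.pi fun _ : Fin (n + 1) => ρ with hP
  let c : (Fin (n + 1) → ι) → ι → ℝ := fun l i => (Finset.univ.filter fun j => l j = i).card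
  let p : ι → ℝ := fun i => (n + 1 : ℕ) * ρ.real {i}
  have hpt : ∀ l : Fin (n + 1) → ι, edist (iterBar mid (n + 1) fun j => y (l' j))
      (iterBar mid (n + 1) fun j => y (l j)) ≤ ENNReal.ofReal
        (D / (n + 1 : ℕ) * ∑ i, (|c l' i - p i| + |c l i - p i|)) := fun l => by
    rw [edist_dist]
    refine ENNReal.ofReal_le_ofReal ?_
    rw [div_mul_eq_mul_div, le_div_iff₀ hn, mul_comm]
    refine ((h.symmetricMean n).dist_comp_le y D hD l' l).trans
      (mul_le_mul_of_nonneg_left (Finset.sum_le_sum fun i _ => ?_) hD0)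
    rw [abs_sub_comm (c l i)]
    exact abs_sub_le _ _ _
  refine (lintegral_mono hpt).trans ?_
  rw [← ofReal_integral_eq_lintegral_ofReal Integrable.of_finite
    (Eventually.of_forall fun l => by positivity)]
  refine ENNReal.ofReal_le_ofReal ?_
  rw [integral_const_mul, integral_finsetSum _ fun _ _ => Integrable.of_finite]
  refine mul_le_mul_of_nonneg_left ?_ (by positivity)
  calc ∑ i, ∫ l, (|c l' i - p i| + |c l i - p i|) ∂P
      ≤ ∑ i, (|c l' i - p i| + √(n + 1 : ℕ)) := by
        refine Finset.sum_le_sum fun i _ => ?_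
        rw [integral_add Integrable.of_finite Integrable.of_finite, integral_const, probReal_univ,
          one_smul]
        exact add_le_add le_rfl (integral_abs_count_sub_le ρ (n + 1) i)
    _ = _ := by rw [Finset.sum_add_distrib]; simp [c, p]

theorem exists_meanDist_map_le (h : ContractingMid mid) (ρ : Measure ι) [IsProbabilityMeasure ρ]
    (y : ι → X) {ε : ℝ≥0∞} (hε : 0 < ε) : ∃ n z, meanDist mid (ρ.map y) (n + 1) z ≤ ε := by
  obtain ⟨D, hD⟩ : ∃ D, ∀ i j, dist (y i) (y j) ≤ D :=
    ⟨Metric.diam (range y), fun i j => Metric.dist_le_diam_of_mem (finite_range y).isBounded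
      (mem_range_self i) (mem_range_self j)⟩
  have hι : Nonempty ι := by
    by_contra hι
    rw [not_nonempty_iff] at hι
    exact IsProbabilityMeasure.ne_zero ρ (Measure.eq_zero_of_isEmpty ρ)
  have hD0 : 0 ≤ D := dist_nonneg.trans (hD hι.some hι.some)
  have hbound : ∀ n : ℕ, ∃ z, meanDist mid (ρ.map y) (n + 1) z ≤
      ENNReal.ofReal (D * (2 * Fintype.card ι) * (1 / √(n + 1 : ℕ))) := fun n => by
    have hn : (0 : ℝ) < (n + 1 : ℕ) := by exact_mod_cast n.succ_pos
    -- Some sample deviates no more than average; its barycenter serves as `z`.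
    obtain ⟨l', hl'⟩ := exists_le_integral (μ := Measure.pi fun _ : Fin (n + 1) => ρ)
      (f := fun l => ∑ i, |((Finset.univ.filter fun j => l j = i).card : ℝ)
        - (n + 1 : ℕ) * ρ.real {i}|) Integrable.of_finite
    refine ⟨_, (h.meanDist_map_le ρ y D hD n l').trans (ENNReal.ofReal_le_ofReal ?_)⟩
    rw [integral_finsetSum _ fun _ _ => Integrable.of_finite] at hl'
    have h2 := hl'.trans (Finset.sum_le_sum fun i _ => integral_abs_count_sub_le ρ (n + 1) i)
    rw [Finset.sum_const, Finset.card_univ, nsmul_eq_mul] at h2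
    have hs : √((n + 1 : ℕ) : ℝ) * √((n + 1 : ℕ) : ℝ) = (n + 1 : ℕ) := Real.mul_self_sqrt hn.le
    have hs0 : (0 : ℝ) < √((n + 1 : ℕ) : ℝ) := Real.sqrt_pos.2 hn
    set s := √((n + 1 : ℕ) : ℝ)
    calc _ ≤ D / (n + 1 : ℕ) * (Fintype.card ι * s + Fintype.card ι * s) := by
          gcongr
      _ = _ := by
          rw [← hs]
          field_simp
          ring
  have ht : Tendsto (fun n : ℕ => ENNReal.ofReal
      (D * (2 * Fintype.card ι) * (1 / √(n + 1 : ℕ)))) atTop (𝓝 0) := by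
    have h1 : Tendsto (fun n : ℕ => √((n + 1 : ℕ) : ℝ)) atTop atTop :=
      Real.tendsto_sqrt_atTop.comp (tendsto_natCast_atTop_atTop.comp (tendsto_add_atTop_nat 1))
    have h2 := (tendsto_const_nhds (x := (1 : ℝ))).div_atTop h1
    have h3 := ENNReal.tendsto_ofReal (h2.const_mul (D * (2 * Fintype.card ι)))
    rwa [mul_zero, ENNReal.ofReal_zero] at h3
  obtain ⟨n, hn⟩ := ((tendsto_order.1 ht).2 ε hε).exists
  obtain ⟨z, hz⟩ := hbound n
  exact ⟨n, z, hz.trans hn.le⟩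

end FiniteLabels

theorem exists_meanDist_le (h : ContractingMid mid) (μ : P1 X) {ε : ℝ≥0∞} (hε : 0 < ε) :
    ∃ n z, meanDist mid μ.1 (n + 1) z ≤ ε := by
  classical
  have := μ.2.1
  obtain ⟨g, hg⟩ := μ.exists_simpleFunc_lintegral_edist_lt (ENNReal.half_pos hε.ne')
  let lab : X → g.range := fun x => ⟨g x, g.mem_range_self x⟩
  have hlab : Measurable lab := g.measurable.subtype_mk
  have := Measure.isProbabilityMeasure_map (μ := μ.1) hlab.aemeasurable
  obtain ⟨n, z, hz⟩ := h.exists_meanDist_map_le (μ.1.map lab) Subtype.val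
    (ENNReal.half_pos hε.ne')
  rw [Measure.map_map measurable_subtype_coe hlab] at hz
  have hpair : Measurable fun x => (x, g x) := measurable_id.prodMk g.measurable
  have := Measure.isProbabilityMeasure_map (μ := μ.1) hpair.aemeasurable
  have hc := h.meanDist_le_add_of_coupling (μ.1.map fun x => (x, g x)) n z
  rw [Measure.map_map measurable_fst hpair, Measure.map_map measurable_snd hpair,
    lintegral_map (measurable_fst.edist measurable_snd) hpair] at hc
  have e : μ.1.map (Prod.fst ∘ fun x => (x, g x)) = μ.1 := Measure.map_id
  rw [e] at hc
  refine ⟨n, z, hc.trans ?_⟩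
  rw [← ENNReal.add_halves ε]
  exact add_le_add hz hg.le

theorem exists_tendsto_meanDist (h : ContractingMid mid) (μ : P1 X) :
    ∃ b, Tendsto (fun n => meanDist mid μ.1 (n + 1) b) atTop (𝓝 0) := by
  have := μ.2.1
  have hpos : ∀ k : ℕ, (0 : ℝ≥0∞) < 2⁻¹ ^ k := fun k =>
    ENNReal.pow_pos (by simp) k
  choose n z hz using fun k : ℕ => h.exists_meanDist_le μ (hpos k)
  have hcauchy : CauchySeq z := by
    -- By monotonicity both bounds hold at the larger sample size, and each is at most `2⁻¹ ^ k`;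
    -- hence the constant 2.
    refine cauchySeq_of_edist_le_geometric (2⁻¹) 2 (by simp) (by simp) fun k => ?_
    refine (h.edist_le_meanDist_add μ.1 (max (n k) (n (k + 1))) _ _).trans ?_
    rw [two_mul]
    refine add_le_add ((h.meanDist_antitone μ.1 _ (le_max_left _ _)).trans (hz k))
      ((h.meanDist_antitone μ.1 _ (le_max_right _ _)).trans ((hz (k + 1)).trans ?_))
    exact pow_le_pow_right_of_le_one' (by simp) k.le_succ
  obtain ⟨b, hb⟩ := cauchySeq_tendsto_of_complete hcauchy
  refine ⟨b, ENNReal.tendsto_nhds_zero.2 fun ε hε => ?_⟩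
  have h1 : Tendsto (fun k => edist b (z k) + 2⁻¹ ^ k) atTop (𝓝 0) := by
    have h2 := (tendsto_const_nhds (x := b)).edist hb
    have h3 := ENNReal.tendsto_pow_atTop_nhds_zero_of_lt_one (r := 2⁻¹) (by simp)
    simpa using h2.add h3
  obtain ⟨k, hk⟩ := ((tendsto_order.1 h1).2 ε hε).exists
  filter_upwards [eventually_ge_atTop (n k)] with N hN
  refine (meanDist_le_edist_add mid μ.1 (N + 1) b (z k)).trans (le_trans ?_ hk.le)
  gcongr
  exact (h.meanDist_antitone μ.1 _ hN).trans (hz k)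

/-- For each coupling, `b` and `b'` are compared through random barycenters of law `μ`; replacing
`μ` by `ν` at `b'` costs one transport, and the rest vanishes in the limit. -/
theorem edist_le_of_tendsto_meanDist (h : ContractingMid mid) {μ ν : P1 X} {b b' : X}
    (hb : Tendsto (fun n => meanDist mid μ.1 (n + 1) b) atTop (𝓝 0))
    (hb' : Tendsto (fun n => meanDist mid ν.1 (n + 1) b') atTop (𝓝 0)) :
    edist b b' ≤ W1 μ ν := by
  have := μ.2.1
  refine le_iInf₂ fun π hπ => ?_
  have hprob : IsProbabilityMeasure π := by
    refine ⟨?_⟩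
    rw [← preimage_univ (f := Prod.fst), ← Measure.map_apply measurable_fst MeasurableSet.univ, hπ.1]
    exact measure_univ
  have hle : ∀ n, edist b b' ≤ meanDist mid μ.1 (n + 1) b +
      (meanDist mid ν.1 (n + 1) b' + ∫⁻ p, edist p.1 p.2 ∂π) := fun n => by
    refine (h.edist_le_meanDist_add μ.1 n b b').trans ?_
    have := h.meanDist_le_add_of_coupling π n b'
    rw [hπ.1, hπ.2] at this
    gcongr
  have := hb.add (hb'.add (tendsto_const_nhds (x := ∫⁻ p, edist p.1 p.2 ∂π)))
  rw [zero_add, zero_add] at this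
  exact ge_of_tendsto' this hle

end ContractingMid

/-! ### Rational atomic measures -/

section RationalAtomic

variable {X : Type*} [MetricSpace X] [MeasurableSpace X] [BorelSpace X]

theorem P1.uniform_real_singleton [DecidableEq X] {n : ℕ} (hn : 0 < n) (Q : Fin n → X) (x : X) :
    (P1.uniform hn Q).1.real {x} = (n : ℝ)⁻¹ * ∑ i, if Q i = x then (1 : ℝ) else 0 := by
  simp only [P1.uniform, Measure.real, Measure.smul_apply, Measure.coe_finsetSum, Finset.sum_apply,
    smul_eq_mul, ENNReal.toReal_mul, ENNReal.toReal_inv, ENNReal.toReal_natCast]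
  congr 1
  rw [ENNReal.toReal_sum fun i _ => measure_ne_top _ _]
  refine Finset.sum_congr rfl fun i _ => ?_
  rw [Measure.dirac_apply' _ (measurableSet_singleton x)]
  by_cases h : Q i = x <;> simp [h]

theorem P1.uniform_compl_eq_zero [DecidableEq X] {n : ℕ} (hn : 0 < n) (Q : Fin n → X) :
    (P1.uniform hn Q).1 (↑(Finset.univ.image Q))ᶜ = 0 := by
  simp only [P1.uniform, Measure.smul_apply, Measure.coe_finsetSum, Finset.sum_apply, smul_eq_mul]
  rw [Finset.sum_eq_zero, mul_zero]
  intro i _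
  rw [Measure.dirac_apply' _ (Finset.measurableSet _).compl]
  simp

theorem measure_ext_of_finset {μ ν : Measure X} [IsProbabilityMeasure μ] [IsProbabilityMeasure ν]
    {s : Finset X} (hs : μ (↑s)ᶜ = 0) (h : ∀ x, μ.real {x} = ν.real {x}) : μ = ν := by
  classical
  have h' : ∀ x, μ {x} = ν {x} := fun x =>
    (ENNReal.toReal_eq_toReal_iff' (measure_ne_top _ _) (measure_ne_top _ _)).1 (h x)
  have hfin : ∀ t : Finset X, μ t = ν t := fun t => by
    rw [← sum_measure_singleton, ← sum_measure_singleton]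
    exact Finset.sum_congr rfl fun x _ => h' x
  have hs' : ν (↑s)ᶜ = 0 := by
    rw [prob_compl_eq_zero_iff s.measurableSet, ← hfin]
    rwa [prob_compl_eq_zero_iff s.measurableSet] at hs
  ext t _
  rw [← measure_inter_conull hs, ← measure_inter_conull hs']
  have : t ∩ ↑s = ((s.filter (· ∈ t) : Finset X) : Set X) := by
    ext x; simp [and_comm]
  rw [this, hfin]

theorem P1.isRationalAtomic_iff (μ : P1 X) : IsRationalAtomic μ ↔
    ∃ (n : ℕ) (hn : 0 < n) (Q : Fin n → X), μ = P1.uniform hn Q := by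
  classical
  constructor
  · rintro ⟨⟨s, hs⟩, hq⟩
    have := μ.2.1
    choose q hq using hq
    -- A common denominator of the masses; each atom `x` is then listed `m x = N μ{x}` times.
    let N := ∏ x ∈ s, (q x).den
    have hN : 0 < N := Finset.prod_pos fun x _ => (q x).den_pos
    have hN' : (0 : ℝ) < N := by exact_mod_cast hN
    have hm : ∀ x ∈ s, ∃ m : ℕ, (m : ℝ) = N * μ.1.real {x} := by
      intro x hx
      obtain ⟨c, hc⟩ : (q x).den ∣ N := Finset.dvd_prod_of_mem _ hx
      have h0 : (0 : ℝ) ≤ (q x : ℝ) := by rw [← hq]; exact measureReal_nonneg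
      have h0' : 0 ≤ (q x).num := Rat.num_nonneg.2 (by exact_mod_cast h0)
      refine ⟨c * (q x).num.toNat, ?_⟩
      have h1 : (((q x).num.toNat : ℤ) : ℝ) = (q x).num := by rw [Int.toNat_of_nonneg h0']
      have h2 : ((q x).den : ℝ) ≠ 0 := by exact_mod_cast (q x).den_nz
      rw [hq, hc, Rat.cast_def]
      push_cast at h1 ⊢
      rw [h1]
      field_simp
    choose! m hm using hm
    have hsum : ∑ x : s, m x = N := by
      rw [Finset.sum_coe_sort s m]
      have h1 : μ.1.real s = 1 := by
        rw [measureReal_def, (prob_compl_eq_zero_iff s.measurableSet).1 hs]; simp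
      have : ((∑ x ∈ s, m x : ℕ) : ℝ) = N := by
        rw [Nat.cast_sum, Finset.sum_congr rfl hm, ← Finset.mul_sum, sum_measureReal_singleton, h1,
          mul_one]
      exact_mod_cast this
    let e : Fin N ≃ Σ x : s, Fin (m x) := Fintype.equivOfCardEq (by
      rw [Fintype.card_fin, Fintype.card_sigma]; simp only [Fintype.card_fin]; exact hsum.symm)
    refine ⟨N, hN, fun i => (e i).1, Subtype.ext ?_⟩
    have := (P1.uniform hN fun i => ((e i).1 : X)).2.1
    refine measure_ext_of_finset hs fun y => ?_
    have hS : ∑ p : (Σ x : s, Fin (m x)), (if (p.1 : X) = y then (1 : ℝ) else 0)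
        = if y ∈ s then (m y : ℝ) else 0 := by
      rw [Fintype.sum_sigma]
      change ∑ x : s, ∑ _i : Fin (m x), (if (x : X) = y then (1 : ℝ) else 0) = _
      simp only [Finset.sum_const, Finset.card_univ, Fintype.card_fin, nsmul_eq_mul, mul_ite,
        mul_one, mul_zero]
      rw [Finset.sum_coe_sort s (fun x => if x = y then (m x : ℝ) else 0), Finset.sum_ite_eq']
    rw [P1.uniform_real_singleton, Fintype.sum_equiv e _
      (fun p => if (p.1 : X) = y then (1 : ℝ) else 0) fun _ => rfl, hS]
    split_ifs with hy
    · rw [hm y hy]; field_simp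
    · rw [mul_zero, measureReal_def, measure_mono_null (by simpa using hy) hs]; rfl
  · rintro ⟨n, hn, Q, rfl⟩
    refine ⟨⟨_, P1.uniform_compl_eq_zero hn Q⟩, fun x => ?_⟩
    refine ⟨(n : ℚ)⁻¹ * ∑ i, if Q i = x then (1 : ℚ) else 0, ?_⟩
    rw [P1.uniform_real_singleton]
    simp only [Rat.cast_mul, Rat.cast_inv, Rat.cast_natCast, Rat.cast_sum,
      apply_ite (Rat.cast (K := ℝ)), Rat.cast_one, Rat.cast_zero]

theorem exists_rat_of_forall_ne {ν : Measure X} [IsProbabilityMeasure ν] {s : Finset X}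
    (hs : ν (↑s)ᶜ = 0) {y₀ : X} (h : ∀ y ≠ y₀, ∃ q : ℚ, ν.real {y} = q) :
    ∃ q : ℚ, ν.real {y₀} = q := by
  classical
  have : ∀ y, ∃ q : ℚ, y ≠ y₀ → ν.real {y} = q := fun y => by
    by_cases hy : y = y₀
    · exact ⟨0, fun h => absurd hy h⟩
    · obtain ⟨q, hq⟩ := h y hy; exact ⟨q, fun _ => hq⟩
  choose q hq using this
  have h1 : ν.real (insert y₀ s : Finset X) = 1 := by
    have : ν ((insert y₀ s : Finset X) : Set X)ᶜ = 0 :=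
      measure_mono_null (compl_subset_compl.2 (by simp)) hs
    rw [measureReal_def, (prob_compl_eq_zero_iff (Finset.measurableSet _)).1 this]; simp
  rw [← sum_measureReal_singleton, ← Finset.add_sum_erase _ _ (Finset.mem_insert_self y₀ s),
    Finset.sum_congr rfl fun y hy => hq y (Finset.ne_of_mem_erase hy)] at h1
  refine ⟨1 - ∑ y ∈ (insert y₀ s).erase y₀, q y, ?_⟩
  push_cast
  linarith

end RationalAtomic

/-! ### Density of the rational atomic measures -/

section Density

variable {X : Type*} [MetricSpace X] [SecondCountableTopology X] [Nonempty X] [MeasurableSpace X]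
  [BorelSpace X]

/-- The proportion of a mass `p` that is kept when rounding down to a multiple of `1 / M`. -/
noncomputable def roundRatio (M : ℕ) (p : ℝ) : ℝ≥0∞ := ENNReal.ofReal (⌊p * M⌋₊ / (p * M))

theorem roundRatio_le_one (M : ℕ) {p : ℝ} (hp : 0 ≤ p) : roundRatio M p ≤ 1 := by
  rw [roundRatio, ENNReal.ofReal_le_one]
  exact div_le_one_of_le₀ (Nat.floor_le (by positivity)) (by positivity)

theorem tendsto_roundRatio {p : ℝ} (hp : 0 < p) :
    Tendsto (fun M => roundRatio M p) atTop (𝓝 1) := by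
  have h := (tendsto_nat_floor_mul_div_atTop (R := ℝ) hp.le).comp tendsto_natCast_atTop_atTop
  have h2 := ENNReal.tendsto_ofReal (h.div_const p)
  rw [div_self hp.ne', ENNReal.ofReal_one] at h2
  refine h2.congr fun M => ?_
  simp only [roundRatio, Function.comp_apply, div_div, mul_comm]

/-- Of the mass at `x`, a proportion `h M x` is paired with `g x`, rounding atoms down to multiples
of `1 / M`, and the rest is paired with `y₀`. The first part costs little by the choice of `g`, the
second tends to 0 with `M` by dominated convergence. -/
theorem P1.exists_isRationalAtomic_W1_lt (μ : P1 X) (ε : ℝ≥0∞) (hε : 0 < ε) :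
    ∃ ν : P1 X, IsRationalAtomic ν ∧ W1 ν μ < ε := by
  classical
  have := μ.2.1
  let y₀ : X := Classical.arbitrary X
  obtain ⟨g, hg⟩ := μ.exists_simpleFunc_lintegral_edist_lt (ENNReal.half_pos hε.ne')
  let p : X → ℝ := fun y => μ.1.real (g ⁻¹' {y})
  let h : ℕ → SimpleFunc X ℝ≥0∞ := fun M => g.map fun y => roundRatio M (p y)
  have hh : ∀ M x, h M x = roundRatio M (p (g x)) := fun M x => rfl
  have h1 : ∀ M x, h M x ≤ 1 := fun M x => roundRatio_le_one M measureReal_nonneg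
  -- On null level sets the ratio is `0 / 0 = 0` and does not tend to 1, so they must be discarded.
  have hae : ∀ᵐ x ∂μ.1, 0 < p (g x) := by
    have : {x | ¬ 0 < p (g x)} ⊆ ⋃ y ∈ (g.range.filter fun y => p y = 0), g ⁻¹' {y} := by
      intro x hx
      simp only [mem_iUnion, Finset.mem_filter]
      exact ⟨g x, ⟨g.mem_range_self x, le_antisymm (not_lt.1 hx) measureReal_nonneg⟩, rfl⟩
    refine measure_mono_null this ((measure_biUnion_null_iff (Finset.countable_toSet _)).2 ?_)
    intro y hy
    exact (measureReal_eq_zero_iff (measure_ne_top _ _)).1 (Finset.mem_filter.1 hy).2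
  have hy₀ : Measurable fun x : X => edist y₀ x := measurable_edist_right
  have ht : Tendsto (fun M => ∫⁻ x, (1 - h M x) * edist y₀ x ∂μ.1) atTop (𝓝 (∫⁻ _, 0 ∂μ.1)) := by
    refine tendsto_lintegral_of_dominated_convergence (fun x => edist y₀ x)
      (fun M => (measurable_const.sub (h M).measurable).mul hy₀)
      (fun M => Eventually.of_forall fun x => ?_) (μ.2.2 y₀).ne ?_
    · exact mul_le_of_le_one_left' tsub_le_self
    · filter_upwards [hae] with x hx
      have e1 := ENNReal.Tendsto.sub (tendsto_const_nhds (x := (1 : ℝ≥0∞)))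
        (tendsto_roundRatio hx) (Or.inl ENNReal.one_ne_top)
      have e2 := ENNReal.Tendsto.mul_const (b := edist y₀ x) e1 (Or.inr (edist_ne_top _ _))
      rwa [tsub_self, zero_mul] at e2
  rw [lintegral_zero] at ht
  obtain ⟨M, hM, hM0⟩ := (((tendsto_order.1 ht).2 _ (ENNReal.half_pos hε.ne')).and
    (eventually_gt_atTop 0)).exists
  have hM' : (0 : ℝ) < M := by exact_mod_cast hM0
  have m1 : Measurable fun x => (g x, x) := g.measurable.prodMk measurable_id
  have m2 : Measurable fun x : X => (y₀, x) := measurable_const.prodMk measurable_id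
  have mh : Measurable fun x => h M x := (h M).measurable
  have mh' : Measurable fun x => 1 - h M x := measurable_const.sub mh
  have md : Measurable fun p : X × X => edist p.1 p.2 := measurable_fst.edist measurable_snd
  let π : Measure (X × X) := (μ.1.withDensity fun x => h M x).map (fun x => (g x, x)) +
    (μ.1.withDensity fun x => 1 - h M x).map (fun x => (y₀, x))
  have hsnd : π.map Prod.snd = μ.1 := by
    rw [Measure.map_add _ _ measurable_snd, Measure.map_map measurable_snd m1,
      Measure.map_map measurable_snd m2]
    have e1 : (Prod.snd ∘ fun x => (g x, x)) = id := rfl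
    have e2 : (Prod.snd ∘ fun x : X => (y₀, x)) = id := rfl
    rw [e1, e2, Measure.map_id, Measure.map_id, ← withDensity_add_left mh]
    have e3 : ((fun x => h M x) + fun x => 1 - h M x) = 1 :=
      funext fun x => add_tsub_cancel_of_le (h1 M x)
    rw [e3, withDensity_one]
  have hcost : ∫⁻ p, edist p.1 p.2 ∂π < ε := by
    have c1 : ∫⁻ p, edist p.1 p.2 ∂((μ.1.withDensity fun x => h M x).map fun x => (g x, x))
        = ∫⁻ x, h M x * edist (g x) x ∂μ.1 := by
      rw [lintegral_map md m1]
      exact lintegral_withDensity_eq_lintegral_mul _ mh (md.comp m1)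
    have c2 : ∫⁻ p, edist p.1 p.2 ∂((μ.1.withDensity fun x => 1 - h M x).map fun x => (y₀, x))
        = ∫⁻ x, (1 - h M x) * edist y₀ x ∂μ.1 := by
      rw [lintegral_map md m2]
      exact lintegral_withDensity_eq_lintegral_mul _ mh' (md.comp m2)
    rw [lintegral_add_measure, c1, c2, ← ENNReal.add_halves ε]
    refine ENNReal.add_lt_add (lt_of_le_of_lt (lintegral_mono fun x => ?_) hg) hM
    rw [edist_comm]
    exact mul_le_of_le_one_left' (h1 M x)
  have hπ : IsProbabilityMeasure π := by
    refine ⟨?_⟩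
    rw [← preimage_univ (f := Prod.snd), ← Measure.map_apply measurable_snd MeasurableSet.univ,
      hsnd]
    exact measure_univ
  have hfst : IsProbabilityMeasure (π.map Prod.fst) :=
    Measure.isProbabilityMeasure_map measurable_fst.aemeasurable
  let ν : P1 X := ⟨π.map Prod.fst, hfst, fun z => by
    have mz : Measurable fun y : X => edist z y := measurable_edist_right
    rw [lintegral_map mz measurable_fst]
    calc ∫⁻ p, edist z p.1 ∂π ≤ ∫⁻ p, (edist z p.2 + edist p.1 p.2) ∂π :=
          lintegral_mono fun p => edist_triangle_right _ _ _
      _ = ∫⁻ y, edist z y ∂μ.1 + ∫⁻ p, edist p.1 p.2 ∂π := by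
          have mz' : Measurable fun p : X × X => edist z p.2 := mz.comp measurable_snd
          rw [lintegral_add_left mz', ← lintegral_map mz measurable_snd, hsnd]
      _ < ∞ := ENNReal.add_lt_top.2 ⟨μ.2.2 z, hcost.trans_le le_top⟩⟩
  have hνapply : ∀ t, MeasurableSet t → y₀ ∉ t → ν.1 t = ∫⁻ x in g ⁻¹' t, h M x ∂μ.1 := by
    intro t ht hyt
    have : ν.1 t = π (Prod.fst ⁻¹' t) := Measure.map_apply measurable_fst ht
    rw [this, Measure.add_apply, Measure.map_apply m1 (measurable_fst ht),
      Measure.map_apply m2 (measurable_fst ht)]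
    have e2 : (fun x : X => (y₀, x)) ⁻¹' (Prod.fst ⁻¹' t) = ∅ := by
      ext x; simpa using hyt
    rw [e2, measure_empty, add_zero]
    exact withDensity_apply _ (g.measurable ht)
  have hsupp : ν.1 (↑(insert y₀ g.range))ᶜ = 0 := by
    rw [hνapply _ (Finset.measurableSet _).compl (by simp)]
    have : g ⁻¹' (↑(insert y₀ g.range))ᶜ = ∅ := by
      ext x; simp
    rw [this]; simp
  have hrat : ∀ y ≠ y₀, ∃ q : ℚ, ν.1.real {y} = q := by
    intro y hy
    refine ⟨⌊p y * M⌋₊ / M, ?_⟩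
    have e : ∫⁻ x in g ⁻¹' {y}, h M x ∂μ.1 = roundRatio M (p y) * μ.1 (g ⁻¹' {y}) := by
      rw [setLIntegral_congr_fun (g := fun _ => roundRatio M (p y))
        (g.measurable (measurableSet_singleton y)), setLIntegral_const]
      intro x hx
      have : g x = y := hx
      simp only [hh, this]
    rw [measureReal_def, hνapply _ (measurableSet_singleton y) (by simpa using hy.symm), e,
      ENNReal.toReal_mul, roundRatio, ENNReal.toReal_ofReal
        (div_nonneg (Nat.cast_nonneg _) (mul_nonneg measureReal_nonneg hM'.le))]
    change _ * p y = _
    push_cast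
    rcases eq_or_ne (p y) 0 with h0 | h0
    · simp [h0]
    · have hcancel : ∀ a q : ℝ, q ≠ 0 → a / (q * M) * q = a / M := fun a q hq => by field_simp
      exact hcancel _ _ h0
  have hνp : IsProbabilityMeasure ν.1 := hfst
  refine ⟨ν, ⟨⟨_, hsupp⟩, fun y => ?_⟩, lt_of_le_of_lt (iInf₂_le π ⟨rfl, hsnd⟩) hcost⟩
  -- The atom at `y₀` also collects all leftovers; its mass is rational because the others are and
  -- the total is 1.
  by_cases hy : y = y₀
  · subst hy; exact exists_rat_of_forall_ne hsupp hrat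
  · exact hrat y hy

end Density

/-! ### The barycenter map -/

theorem card_filter_modNat_eq (k : ℕ) {n : ℕ} (i : Fin n) :
    (Finset.univ.filter fun j : Fin (k * n) => j.modNat = i).card = k := by
  have h : (Finset.univ.filter fun j : Fin (k * n) => j.modNat = i).card
      = ((Finset.univ : Finset (Fin k)) ×ˢ ({i} : Finset (Fin n))).card :=
    Finset.card_equiv finProdFinEquiv.symm fun j => by
      rw [Finset.mem_filter, Finset.mem_product, Finset.mem_singleton]
      simp only [Finset.mem_univ, true_and]
      rfl
  rw [h]; simp

namespace ContractingMid

variable {X : Type*} [MetricSpace X] [CompleteSpace X] [Nonempty X] [MeasurableSpace X]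
  [BorelSpace X] [SecondCountableTopology X] {mid : X → X → X}

theorem tendsto_iterBar_repeat (h : ContractingMid mid) {n : ℕ} (hn : 0 < n) (Q : Fin n → X)
    {b : X} (hb : Tendsto (fun N => meanDist mid (P1.uniform hn Q).1 (N + 1) b) atTop (𝓝 0)) :
    Tendsto (fun k : ℕ => iterBar mid (k * n) (Fin.repeat k Q)) atTop (𝓝 b) := by
  have hn0 : (n : ℝ≥0∞) ≠ 0 := by exact_mod_cast hn.ne'
  have hn' : (0 : ℝ) < n := by exact_mod_cast hn
  -- Labels are indices, not points, so repetitions in `Q` are harmless. In `Q^k` each label occurs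
  -- exactly its expected number of times, which leaves only the `√N` term.
  let ρ : Measure (Fin n) := (n : ℝ≥0∞)⁻¹ • ∑ i, Measure.dirac i
  have hρ : IsProbabilityMeasure ρ :=
    ⟨by simp [ρ, ENNReal.inv_mul_cancel hn0 (ENNReal.natCast_ne_top n)]⟩
  have hmap : ρ.map Q = (P1.uniform hn Q).1 := by
    rw [Measure.map_smul, Measure.map_finset_sum' Measurable.of_discrete.aemeasurable]
    exact congrArg _ (Finset.sum_congr rfl fun i _ => Measure.map_dirac' Measurable.of_discrete i)
  have hρi : ∀ i, ρ.real {i} = (n : ℝ)⁻¹ := fun i => by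
    simp [ρ, Measure.real, Measure.coe_finsetSum, Set.indicator_apply]
  obtain ⟨D, hD⟩ : ∃ D, ∀ i j, dist (Q i) (Q j) ≤ D :=
    ⟨Metric.diam (range Q), fun i j => Metric.dist_le_diam_of_mem (finite_range Q).isBounded
      (mem_range_self i) (mem_range_self j)⟩
  have hle : ∀ N, 0 < N → ∀ l' : Fin N → Fin n, (∀ i, ((Finset.univ.filter fun j => l' j = i).card : ℝ)
      = N * (n : ℝ)⁻¹) → edist (iterBar mid N fun j => Q (l' j)) b ≤
        ENNReal.ofReal (D * n * (1 / √N)) + meanDist mid (P1.uniform hn Q).1 N b := by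
    rintro (_ | m) hN l' hl'
    · exact absurd hN (lt_irrefl 0)
    have := (P1.uniform hn Q).2.1
    refine (h.edist_le_meanDist_add (P1.uniform hn Q).1 m _ b).trans ?_
    gcongr
    have hb' := h.meanDist_map_le ρ Q D hD m l'
    rw [hmap] at hb'
    refine hb'.trans (ENNReal.ofReal_le_ofReal (le_of_eq ?_))
    have hN' : (0 : ℝ) < (m + 1 : ℕ) := by exact_mod_cast hN
    have hs : √((m + 1 : ℕ) : ℝ) * √((m + 1 : ℕ) : ℝ) = (m + 1 : ℕ) := Real.mul_self_sqrt hN'.le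
    have hs0 : (0 : ℝ) < √((m + 1 : ℕ) : ℝ) := Real.sqrt_pos.2 hN'
    simp only [hl', hρi, sub_self, abs_zero, Finset.sum_const_zero, zero_add, Fintype.card_fin]
    set s := √((m + 1 : ℕ) : ℝ)
    rw [← hs]
    field_simp
  have hN : Tendsto (fun k : ℕ => k * n) atTop atTop := tendsto_id.atTop_mul_const' hn
  have hb2 : Tendsto (fun N => meanDist mid (P1.uniform hn Q).1 N b) atTop (𝓝 0) :=
    (tendsto_add_atTop_iff_nat 1).1 hb
  have hs : Tendsto (fun N : ℕ => ENNReal.ofReal (D * n * (1 / √N))) atTop (𝓝 0) := by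
    have h1 : Tendsto (fun N : ℕ => √(N : ℝ)) atTop atTop :=
      Real.tendsto_sqrt_atTop.comp tendsto_natCast_atTop_atTop
    have h3 := ENNReal.tendsto_ofReal
      (((tendsto_const_nhds (x := (1 : ℝ))).div_atTop h1).const_mul (D * n))
    rwa [mul_zero, ENNReal.ofReal_zero] at h3
  have hlim := (hs.add hb2).comp hN
  rw [add_zero] at hlim
  refine tendsto_iff_edist_tendsto_0.2 (tendsto_of_tendsto_of_tendsto_of_le_of_le'
    tendsto_const_nhds hlim (Eventually.of_forall fun _ => zero_le) ?_)
  -- At `k = 0` the value of `iterBar` is arbitrary.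
  filter_upwards [eventually_gt_atTop 0] with k hk
  refine hle (k * n) (Nat.mul_pos hk hn) (fun j => j.modNat) fun i => ?_
  rw [card_filter_modNat_eq]
  push_cast
  field_simp

theorem meanDist_P1_map (h : ContractingMid mid) (f : X ≃ᵢ X) (μ : P1 X) (n : ℕ) (z : X) :
    meanDist mid (P1.map f μ).1 (n + 1) (f z) = meanDist mid μ.1 (n + 1) z := by
  have := μ.2.1
  have e := h.meanDist_map μ.1 f.continuous.measurable n (f z)
  refine e.trans (lintegral_congr fun x => ?_)
  rw [← h.map_iterBar, f.edist_eq]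

theorem exists_isBarStar (h : ContractingMid mid) : ∃ b : P1 X → X, IsBarStar mid b := by
  choose b hb using fun μ : P1 X => h.exists_tendsto_meanDist μ
  have hcontract : ∀ μ ν : P1 X, edist (b μ) (b ν) ≤ W1 μ ν := fun μ ν =>
    h.edist_le_of_tendsto_meanDist (hb μ) (hb ν)
  refine ⟨b, fun n => (h.symmetricMean_and_tendsto n).2,
    fun n hn Q => h.tendsto_iterBar_repeat hn Q (hb _), hcontract, ?_, ?_⟩
  · intro b' hb' heq
    funext μ
    refine edist_le_zero.1 (le_of_forall_gt fun ε hε => ?_)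
    obtain ⟨δ, hδ, hcont⟩ := hb' μ (ε / 2) (ENNReal.half_pos hε.ne')
    obtain ⟨ν, hν, hW⟩ := μ.exists_isRationalAtomic_W1_lt (min δ (ε / 2))
      (lt_min hδ (ENNReal.half_pos hε.ne'))
    have h1 := hcont ν (hW.trans_le (min_le_left _ _))
    have h2 := (hcontract ν μ).trans_lt (hW.trans_le (min_le_right _ _))
    rw [heq ν hν] at h1
    rw [← ENNReal.add_halves ε]
    exact (edist_triangle_left _ _ (b ν)).trans_lt (ENNReal.add_lt_add h1 h2)
  · intro f μ
    -- Both `f (b μ)` and `b (P1.map f μ)` have vanishing mean distance for the image law, hence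
    -- coincide.
    have hf : Tendsto (fun n => meanDist mid (P1.map f μ).1 (n + 1) (f (b μ))) atTop (𝓝 0) := by
      simpa only [h.meanDist_P1_map] using hb μ
    have := (P1.map f μ).2.1
    have h0 := (hb (P1.map f μ)).add hf
    rw [add_zero] at h0
    exact edist_le_zero.1 (ge_of_tendsto' h0 fun n => h.edist_le_meanDist_add _ n _ _)

end ContractingMid

/-! ### Separable Banach spaces -/

section Banach

variable {E : Type*} [NormedAddCommGroup E]

/-- By induction each step preserves the sum of the entries; the common limit, counted once per
entry, must have that same sum. -/
theorem iterBar_midpoint [NormedSpace ℝ E] [CompleteSpace E] (n : ℕ) (x : Fin (n + 1) → E) :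
    iterBar (fun x y : E => midpoint ℝ x y) (n + 1) x = ((n + 1 : ℕ) : ℝ)⁻¹ • ∑ i, x i := by
  cases n with
  | zero => simp [iterBar]
  | succ n =>
    induction n with
    | zero =>
      rw [Fin.sum_univ_two]
      simp only [iterBar, midpoint_eq_smul_add]
      norm_num
    | succ n ih =>
      have hsum : ∀ (k : ℕ), ∑ i, (replaceStep (iterBar (fun x y : E => midpoint ℝ x y)
          (n + 2)))^[k] x i = ∑ i, x i := by
        intro k
        induction k with
        | zero => rfl
        | succ k ihk =>
          rw [Function.iterate_succ_apply', ← ihk]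
          generalize (replaceStep (iterBar (fun x y : E => midpoint ℝ x y) (n + 2)))^[k] x = w
          have h0 : ((n + 1 + 1 : ℕ) : ℝ) ≠ 0 := by positivity
          have h1 : ∀ i, ((n + 1 + 1 : ℕ) : ℝ) •
              replaceStep (iterBar (fun x y : E => midpoint ℝ x y) (n + 2)) w i
              = (∑ j, w j) - w i := fun i => by
            rw [replaceStep, ih, smul_inv_smul₀ h0, Fin.sum_univ_succAbove w i]
            abel
          refine smul_right_injective E h0 ?_
          simp only
          rw [Finset.smul_sum, Finset.sum_congr rfl fun i _ => h1 i, Finset.sum_sub_distrib]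
          simp only [Finset.sum_const, Finset.card_univ, Fintype.card_fin]
          rw [succ_nsmul, add_sub_cancel_right, Nat.cast_smul_eq_nsmul]
      have ht := tendsto_finsetSum Finset.univ fun i _ =>
        ((contractingMid_midpoint (E := E)).symmetricMean_and_tendsto n).2 x i
      simp only [hsum] at ht
      have he := tendsto_nhds_unique ht tendsto_const_nhds
      rw [Finset.sum_const, Finset.card_univ, Fintype.card_fin, ← Nat.cast_smul_eq_nsmul ℝ] at he
      rw [← he, inv_smul_smul₀ (by positivity)]

variable [MeasurableSpace E] [BorelSpace E] [SecondCountableTopology E]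

theorem P1.integrable_id (μ : P1 E) : Integrable (fun x : E => x) μ.1 := by
  refine ⟨measurable_id.aestronglyMeasurable, ?_⟩
  have := μ.2.2 0
  simpa only [HasFiniteIntegral, edist_comm (0 : E), edist_zero_right] using this

variable [NormedSpace ℝ E]

theorem edist_integral_le_W1 (μ ν : P1 E) :
    edist (∫ x, x ∂μ.1) (∫ x, x ∂ν.1) ≤ W1 μ ν := by
  refine le_iInf₂ fun π hπ => ?_
  have i1 : Integrable (fun p : E × E => p.1) π := by
    have := μ.integrable_id
    rw [← hπ.1] at this
    exact this.comp_measurable measurable_fst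
  have i2 : Integrable (fun p : E × E => p.2) π := by
    have := ν.integrable_id
    rw [← hπ.2] at this
    exact this.comp_measurable measurable_snd
  rw [← hπ.1, ← hπ.2, integral_map (f := fun x => x) measurable_fst.aemeasurable
    measurable_id.aestronglyMeasurable, integral_map (f := fun x => x) measurable_snd.aemeasurable
    measurable_id.aestronglyMeasurable, edist_eq_enorm_sub, ← integral_sub i1 i2]
  refine (enorm_integral_le_lintegral_enorm _).trans (le_of_eq ?_)
  simp only [edist_eq_enorm_sub]

variable [CompleteSpace E]

theorem integral_P1_uniform {n : ℕ} (hn : 0 < n) (Q : Fin n → E) :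
    ∫ x, x ∂(P1.uniform hn Q).1 = (n : ℝ)⁻¹ • ∑ i, Q i := by
  have : ∀ i, Integrable (fun x : E => x) (Measure.dirac (Q i)) := fun i =>
    integrable_dirac (by simp)
  simp only [P1.uniform]
  rw [integral_smul_measure, integral_finsetSum_measure fun i _ => this i]
  simp

theorem sum_repeat {M : Type*} [AddCommMonoid M] (k : ℕ) {n : ℕ} (Q : Fin n → M) :
    ∑ j, Fin.repeat k Q j = k • ∑ i, Q i := by
  rw [← Finset.sum_fiberwise Finset.univ (fun j : Fin (k * n) => j.modNat), Finset.smul_sum]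
  refine Finset.sum_congr rfl fun i _ => ?_
  rw [Finset.sum_congr rfl (g := fun _ => Q i), Finset.sum_const, card_filter_modNat_eq]
  intro j hj
  rw [Fin.repeat_apply, (Finset.mem_filter.1 hj).2]

/-- The integral is 1-Lipschitz for `W1` and agrees with the abstract map on `P_ℚ`, where
`bar_{nk}(Q^k)` is the mean of `Q` for every `k > 0`; `extension_unique` then identifies the two. -/
theorem isBarStar_integral :
    IsBarStar (fun x y : E => midpoint ℝ x y) (fun μ : P1 E => ∫ x, x ∂μ.1) := by
  obtain ⟨b, hb⟩ := (contractingMid_midpoint (E := E)).exists_isBarStar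
  have hbar : ∀ N, 0 < N → ∀ x : Fin N → E,
      iterBar (fun x y : E => midpoint ℝ x y) N x = (N : ℝ)⁻¹ • ∑ i, x i := by
    rintro (_ | m) hN x
    · exact absurd hN (lt_irrefl 0)
    · exact iterBar_midpoint m x
  have : (fun μ : P1 E => ∫ x, x ∂μ.1) = b := by
    refine hb.extension_unique _ (fun μ ε hε => ⟨ε, hε, fun ν hν =>
      (edist_integral_le_W1 ν μ).trans_lt hν⟩) fun μ hμ => ?_
    obtain ⟨n, hn, Q, rfl⟩ := μ.isRationalAtomic_iff.1 hμ
    refine tendsto_nhds_unique (tendsto_const_nhds.congr' ?_) (hb.uniform n hn Q)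
    filter_upwards [eventually_gt_atTop 0] with k hk
    have hk' : (k : ℝ) ≠ 0 := by exact_mod_cast hk.ne'
    rw [hbar _ (Nat.mul_pos hk hn), sum_repeat, integral_P1_uniform, ← Nat.cast_smul_eq_nsmul ℝ,
      smul_smul]
    congr 1
    push_cast
    field_simp
  rwa [this]

end Banach

theorem mainTheorem2 :
    (∀ (X : Type*) [MetricSpace X] [CompleteSpace X] [TopologicalSpace.SeparableSpace X]
        [Nonempty X] [MeasurableSpace X] [BorelSpace X], IsBusemannSpace X →
      (∀ x y m : X, IsMetricMidpoint x y m ↔ m = metricMidpoint x y) ∧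
      (∀ μ : P1 X, IsRationalAtomic μ ↔
        ∃ (n : ℕ) (hn : 0 < n) (Q : Fin n → X), μ = P1.uniform hn Q) ∧
      (∀ μ : P1 X, ∀ ε : ℝ≥0∞, 0 < ε → ∃ ν : P1 X, IsRationalAtomic ν ∧ W1 ν μ < ε) ∧
      ∃ b : P1 X → X, IsBarStar metricMidpoint b) ∧
    (∀ (E : Type*) [NormedAddCommGroup E] [NormedSpace ℝ E] [CompleteSpace E]
        [TopologicalSpace.SeparableSpace E] [MeasurableSpace E] [BorelSpace E],
      (∀ μ : P1 E, Integrable (fun x : E => x) μ.1) ∧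
      IsBarStar (fun x y : E => midpoint ℝ x y) (fun μ : P1 E => ∫ x, x ∂μ.1)) := by
  refine ⟨fun X _ _ _ _ _ _ hX => ?_, fun E _ _ _ _ _ _ => ?_⟩
  · have : SecondCountableTopology X := UniformSpace.secondCountable_of_separable X
    exact ⟨hX.isMetricMidpoint_iff, P1.isRationalAtomic_iff, P1.exists_isRationalAtomic_W1_lt,
      hX.contractingMid.exists_isBarStar⟩
  · have : SecondCountableTopology E := UniformSpace.secondCountable_of_separable E
    exact ⟨P1.integrable_id, isBarStar_integral⟩
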